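/- Let $M=\mathbb R^4$ with coordinates $q=(x_1,x_2,y,z)$ be the Engel group with the frame $X_1=\partial_{x_1}-\frac{x_2}{2}\partial_y$, $X_2=\partial_{x_2}+\frac{x_1}{2}\partial_y+\frac{x_1^2+x_2^2}{2}\partial_z$, $X_3=\partial_y+x_1\partial_z$, $X_4=\partial_z$, and let $h_i=\langle\xi,X_i\rangle$ and $H=\frac12(-h_1^2+h_2^2)$ on $T^*M$. A normal extremal is a solution $(q(t),\xi(t))$ of the Hamiltonian system $\dot q=\partial H/\partial\xi$, $\dot\xi=-\partial H/\partial q$; derivatives at end points of a time interval are one-sided. The initial covectors $\xi\in T_0^*M$ with $H=-\frac12$, $h_1>0$ are in bijection with $\lambda=(\theta,c,\alpha)\in C=\mathbb R^3$ through $h_1=\cosh\theta$, $h_2=\sinh\theta$, $h_3=c$, $h_4=\alpha$. Put $E=\frac{c^2}{2}-\alpha\sinh\theta$. **Elliptic coordinates.** Let $\alpha\neq0$, $\text{æ}=\sqrt{\sqrt{E^2+\alpha^2}/2}$, $k=\sqrt{\frac12+\frac{E}{4\text{æ}^2}}$. Then $\text{æ}>0$ and $k\in(0,1)$. Let $\mathrm{sn},\mathrm{cn},\mathrm{dn}$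 be the Jacobi functions of modulus $k$, $\mathrm{sc}=\mathrm{sn}/\mathrm{cn}$, $\mathrm{nc}=1/\mathrm{cn}$, $K=\int_0^{\pi/2}\frac{dt}{\sqrt{1-k^2\sin^2t}}$, $\mathrm E(\psi)=\int_0^\psi\mathrm{dn}^2t\,dt$. There is exactly one $\psi_0=\psi_0(\lambda)\in(-K,K)$ with $$c=-2\,\mathrm{sgn}(\alpha)\,\text{æ}\,\mathrm{sc}\psi_0\,\mathrm{dn}\psi_0,\quad \sinh\theta=\frac{2\text{æ}^2(1-k^2(1+\mathrm{cn}^4\psi_0))}{\alpha\,\mathrm{cn}^2\psi_0},\quad \cosh\theta=\frac{2\text{æ}^2(1-k^2(1-\mathrm{cn}^4\psi_0))}{|\alpha|\,\mathrm{cn}^2\psi_0}.$$ Put $\psi_t=\psi_0+\text{æ}t$ and $t_{\sup}(\lambda)=(K-\psi_0)/\text{æ}$, which is positive. For $\alpha=0$ put $t_{\sup}(\lambda)=+\infty$. **Explicit curves $q_\lambda(t)$.** If $\alpha\ne0$, then $q_\lambda(t)=(x_1,x_2,y,z)$ with $$x_1=\frac{2\text{æ}}{|\alpha|}(\mathrm{sc}\psi_0\mathrm{dn}\psi_0-\mathrm{sc}\psi_t\mathrm{dn}\psi_t),\qquad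 x_2=\frac{4\text{æ}\big(\text{æ}(1-k^2)t-(\mathrm E(\psi_t)-\mathrm E(\psi_0))\big)-|\alpha|x_1}{\alpha},$$ $$y=-\frac{2\text{æ}^2}{\alpha|\alpha|}\Big(k^2(\mathrm{cn}^2\psi_t-\mathrm{cn}^2\psi_0)+(1-k^2)(\mathrm{nc}^2\psi_t-\mathrm{nc}^2\psi_0)\Big)+\frac{\text{æ}}{|\alpha|}(\mathrm{dn}\psi_0\mathrm{sc}\psi_0+\mathrm{dn}\psi_t\mathrm{sc}\psi_t)x_2,$$ $$z=\frac{x_2^3}{6}+\frac{4\text{æ}^3}{3\alpha^3}\Big(2\text{æ}(k^2-1)t+(1-k^2)\Big(\frac{\mathrm{dn}\psi_t\mathrm{sn}\psi_t}{\mathrm{cn}^3\psi_t}-\frac{\mathrm{dn}\psi_0\mathrm{sn}\psi_0}{\mathrm{cn}^3\psi_0}\Big)+k^2(\mathrm{cn}\psi_t\mathrm{dn}\psi_t\mathrm{sn}\psi_t-\mathrm{cn}\psi_0\mathrm{dn}\psi_0\mathrm{sn}\psi_0)-2(\mathrm E(\psi_t)-\mathrm E(\psi_0))(2k^2-1)\Big)$$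 $$\qquad-\frac{2\text{æ}\,\mathrm{dn}\psi_0\mathrm{sn}\psi_0\Big(\frac{\text{æ}\,\mathrm{dn}\psi_0\mathrm{sc}\psi_0}{|\alpha|}x_2-\frac12x_1x_2-y\Big)}{\mathrm{cn}\psi_0|\alpha|}-\frac{2\text{æ}^2(2k^2-1)x_1}{3\alpha|\alpha|}.$$ If $\alpha=0$, $c\neq0$ (the set $C^0$), then $$x_1=\frac{\sinh(\theta-ct)-\sinh\theta}{c},\quad x_2=\frac{\cosh\theta-\cosh(\theta-ct)}{c},\quad y=\frac{\sinh(ct)-ct}{2c^2},$$ $$z=\frac{4\sinh^3(\frac{ct}{2})\sinh(3\theta-\frac{3ct}{2})-3(\sinh(ct)-ct)\sinh\theta}{6c^3}.$$ If $\alpha=c=0$ (the set $C^0_0$), then $x_1=-t\cosh\theta$, $x_2=t\sinh\theta$, $y=0$, $z=\frac{(2\sinh^2\theta+1)\sinh\theta}{6}t^3$. **Claim.** 1. For every $\lambda\in C$ there is a normal extremal on $[0,t_{\sup}(\lambda))$ with $q(0)=0$ and initial covector $\lambda$. 2. Let $(q,\xi)$ be any normal extremal on $[0,T]$, $T>0$,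 with $q(0)=0$ and initial covector $\lambda$. Then $T<t_{\sup}(\lambda)$, and for all $t\in[0,T]$ one has $q(t)=q_\lambda(t)$ and $\xi(t)$ has coordinates $(\theta_t,c_t,\alpha)$ (that is, $h_1=\cosh\theta_t$, $h_2=\sinh\theta_t$, $h_3=c_t$, $h_4=\alpha$ at $(q(t),\xi(t))$); if $\alpha\ne0$, these have the same energy $E$ and elliptic coordinate $\psi_t$; if $\alpha=0$, then $\theta_t=\theta-ct$ and $c_t=c$. 3. If $\alpha\ne0$, the absolute value of each of the four coordinates of $q_\lambda(t)$ tends to $+\infty$ as $t\to t_{\sup}(\lambda)-0$. 4. Consequently the exponential map $\mathrm{Exp}:N\to\mathbb R^4$, $N=\{(\lambda,t)\in C\times\mathbb R_+: 0<t<t_{\sup}(\lambda)\}$, which sends $(\lambda,t)$ to the point $q(t)$ of the extremal from the origin with initial covector $\lambda$, is well defined and $\mathrm{Exp}(\lambda,t)=q_\lambda(t)$. 5. Let $(q,\xi)$ be any normal extremal on $[0,T]$, $T>0$, with $q(0)=0$ and $H=-\frac12$ at $t=0$. Then there is $\lambda\in C$ with $T<t_{\sup}(\lambda)$ such that either $h_1>0$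 at $t=0$, $\lambda$ is the initial covector and $q=q_\lambda$ on $[0,T]$, or $h_1<0$ at $t=0$, the initial values $(-h_1,h_2,-h_3,h_4)$ equal $(\cosh\theta,\sinh\theta,c,\alpha)$ and $q$ is the image of $q_\lambda$ under $(x_1,x_2,y,z)\mapsto(-x_1,x_2,-y,z)$ on $[0,T]$. -/

import Mathlib

open Set Filter Topology

noncomputable section

namespace Engel

/-! ### Jacobi elliptic functions of modulus `k` -/

/-- Incomplete elliptic integral of the first kind. -/
def ellipticF (k φ : ℝ) : ℝ :=
  ∫ t in (0 : ℝ)..φ, 1 / Real.sqrt (1 - k ^ 2 * Real.sin t ^ 2)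

/-- Complete elliptic integral of the first kind. -/
def ellipticK (k : ℝ) : ℝ := ellipticF k (Real.pi / 2)

/-- Jacobi amplitude: the inverse function of `φ ↦ ellipticF k φ`
(a bijection of the line when `0 < k < 1`, see `ellipticF_bijective`). -/
def jacobiAm (k u : ℝ) : ℝ := Function.invFun (ellipticF k) u

def jacobiSn (k u : ℝ) : ℝ := Real.sin (jacobiAm k u)

def jacobiCn (k u : ℝ) : ℝ := Real.cos (jacobiAm k u)

def jacobiDn (k u : ℝ) : ℝ := Real.sqrt (1 - k ^ 2 * jacobiSn k u ^ 2)

def jacobiSc (k u : ℝ) : ℝ := jacobiSn k u / jacobiCn k u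

def jacobiNc (k u : ℝ) : ℝ := 1 / jacobiCn k u

/-- `E(ψ) = ∫₀^ψ dn² t dt`. -/
def jacobiE (k ψ : ℝ) : ℝ := ∫ t in (0 : ℝ)..ψ, jacobiDn k t ^ 2

theorem ellipticF_bijective {k : ℝ} (hk : k ∈ Ioo (0 : ℝ) 1) :
    Function.Bijective (ellipticF k) := by
  have hpos : ∀ t : ℝ, 0 < 1 - k ^ 2 * Real.sin t ^ 2 := by
    intro t
    have h1 : k ^ 2 < 1 := by nlinarith [hk.1, hk.2]
    nlinarith [Real.sin_sq_le_one t, sq_nonneg k, sq_nonneg (Real.sin t)]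
  have hcont : Continuous fun t : ℝ => 1 / Real.sqrt (1 - k ^ 2 * Real.sin t ^ 2) := by
    refine continuous_const.div (by fun_prop) fun t => ?_
    exact (Real.sqrt_pos.2 (hpos t)).ne'
  have hone : ∀ t : ℝ, 1 ≤ 1 / Real.sqrt (1 - k ^ 2 * Real.sin t ^ 2) := by
    intro t
    rw [le_div_iff₀ (Real.sqrt_pos.2 (hpos t)), one_mul]
    exact Real.sqrt_le_one.2 (by nlinarith [sq_nonneg (k * Real.sin t)])
  have hgrow : ∀ a b : ℝ, a ≤ b → b - a ≤ ellipticF k b - ellipticF k a := by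
    intro a b hab
    have h := intervalIntegral.integral_mono_on hab
      (intervalIntegrable_const (μ := MeasureTheory.volume) (c := (1 : ℝ)))
      (hcont.intervalIntegrable a b) (fun t _ => hone t)
    have h2 : ellipticF k b - ellipticF k a
        = ∫ t in a..b, 1 / Real.sqrt (1 - k ^ 2 * Real.sin t ^ 2) :=
      intervalIntegral.integral_interval_sub_left
        (hcont.intervalIntegrable _ _) (hcont.intervalIntegrable _ _)
    rw [h2]
    simpa using h
  have hF0 : ellipticF k 0 = 0 := by simp [ellipticF]
  have hFc : Continuous (ellipticF k) :=
    intervalIntegral.continuous_primitive (fun a b => hcont.intervalIntegrable a b) 0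
  constructor
  · have hm : StrictMono (ellipticF k) := fun a b hab => by
      have := hgrow a b hab.le
      linarith
    exact hm.injective
  · refine hFc.surjective ?_ ?_
    · refine tendsto_atTop_mono' atTop ?_ tendsto_id
      filter_upwards [eventually_ge_atTop (0 : ℝ)] with b hb
      have := hgrow 0 b hb
      simp only [id]
      linarith
    · refine tendsto_atBot_mono' atBot ?_ tendsto_id
      filter_upwards [eventually_le_atBot (0 : ℝ)] with b hb
      have := hgrow b 0 hb
      simp only [id]
      linarith

/-! ### The left-invariant frame and the normal Hamiltonian system on the Engel group

A point of the Engel group is `q = (x₁, x₂, y, z) = (q 0, q 1, q 2, q 3)`; a covector at `q` is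
`ξ = (ξ 0, ξ 1, ξ 2, ξ 3)` in the dual coordinates. -/

def X₁ (q : Fin 4 → ℝ) : Fin 4 → ℝ := ![1, 0, -(q 1 / 2), 0]

def X₂ (q : Fin 4 → ℝ) : Fin 4 → ℝ := ![0, 1, q 0 / 2, (q 0 ^ 2 + q 1 ^ 2) / 2]

def X₃ (q : Fin 4 → ℝ) : Fin 4 → ℝ := ![0, 0, 1, q 0]

def X₄ (_q : Fin 4 → ℝ) : Fin 4 → ℝ := ![0, 0, 0, 1]

/-- The value `⟨ξ, v⟩` of a covector on a vector. -/
def pairing (ξ v : Fin 4 → ℝ) : ℝ := ∑ i, ξ i * v i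

def h₁ (q ξ : Fin 4 → ℝ) : ℝ := pairing ξ (X₁ q)

def h₂ (q ξ : Fin 4 → ℝ) : ℝ := pairing ξ (X₂ q)

def h₃ (q ξ : Fin 4 → ℝ) : ℝ := pairing ξ (X₃ q)

def h₄ (q ξ : Fin 4 → ℝ) : ℝ := pairing ξ (X₄ q)

/-- The sub-Lorentzian Hamiltonian of the metric `g(X₁,X₁) = -1`, `g(X₂,X₂) = 1`,
`g(X₁,X₂) = 0`. -/
def hamiltonian (q ξ : Fin 4 → ℝ) : ℝ := (-(h₁ q ξ) ^ 2 + h₂ q ξ ^ 2) / 2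

/-- `∂H/∂ξᵢ`. -/
def dHdξ (q ξ : Fin 4 → ℝ) (i : Fin 4) : ℝ :=
  deriv (fun s => hamiltonian q (Function.update ξ i s)) (ξ i)

/-- `∂H/∂qᵢ`. -/
def dHdq (q ξ : Fin 4 → ℝ) (i : Fin 4) : ℝ :=
  deriv (fun s => hamiltonian (Function.update q i s) ξ) (q i)

/-- `(q, ξ)` solves Hamilton's equations on the time set `s`: the curve `q` is a normal
extremal trajectory with normal lift `(q, ξ)`. Derivatives at end points of `s` are one-sided. -/
structure IsNormalExtremal (q ξ : ℝ → Fin 4 → ℝ) (s : Set ℝ) : Prop where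
  q_eq : ∀ t ∈ s, ∀ i, HasDerivWithinAt (fun τ => q τ i) (dHdξ (q t) (ξ t) i) s t
  ξ_eq : ∀ t ∈ s, ∀ i, HasDerivWithinAt (fun τ => ξ τ i) (-dHdq (q t) (ξ t) i) s t

/-- A point `(θ, c, α)` of the parameter space `C = ℝ³` of covectors with
`H = -1/2` and `h₁ > 0`. -/
@[ext]
structure Covector where
  θ : ℝ
  c : ℝ
  α : ℝ

/-- The covector `ξ` at `q` has coordinates `l = (θ, c, α)`:
`h₁ = cosh θ`, `h₂ = sinh θ`, `h₃ = c`, `h₄ = α`. -/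
def HasCoords (q ξ : Fin 4 → ℝ) (l : Covector) : Prop :=
  h₁ q ξ = Real.cosh l.θ ∧ h₂ q ξ = Real.sinh l.θ ∧ h₃ q ξ = l.c ∧ h₄ q ξ = l.α

/-- `(q, ξ)` is a normal extremal on `s`, starting at time `0` from the origin with initial
covector `l`. -/
def IsExtremalFrom (l : Covector) (q ξ : ℝ → Fin 4 → ℝ) (s : Set ℝ) : Prop :=
  IsNormalExtremal q ξ s ∧ q 0 = 0 ∧ HasCoords (q 0) (ξ 0) l

/-! ### Elliptic coordinates in the case `α ≠ 0` -/

/-- The energy `E = c²/2 - α sinh θ`. -/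
def energy (l : Covector) : ℝ := l.c ^ 2 / 2 - l.α * Real.sinh l.θ

/-- `æ = √(√(E² + α²)/2)`. -/
def ae (l : Covector) : ℝ := Real.sqrt (Real.sqrt (energy l ^ 2 + l.α ^ 2) / 2)

/-- The modulus `k`, with `k² = 1/2 + E/(4æ²)`. -/
def modulus (l : Covector) : ℝ := Real.sqrt (1 / 2 + energy l / (4 * ae l ^ 2))

/-- `ψ = æφ` is the elliptic coordinate of `l` (for `α ≠ 0`). For `α < 0` this says that `ψ` is
the elliptic coordinate of the mirror point `(-θ, -c, -α)`. -/
def IsPhase (l : Covector) (ψ : ℝ) : Prop :=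
  ψ ∈ Ioo (-ellipticK (modulus l)) (ellipticK (modulus l)) ∧
  l.c = -(Real.sign l.α * (2 * ae l * jacobiSc (modulus l) ψ * jacobiDn (modulus l) ψ)) ∧
  Real.sinh l.θ =
    2 * ae l ^ 2 * (1 - modulus l ^ 2 * (1 + jacobiCn (modulus l) ψ ^ 4)) /
      (l.α * jacobiCn (modulus l) ψ ^ 2) ∧
  Real.cosh l.θ =
    2 * ae l ^ 2 * (1 - modulus l ^ 2 * (1 - jacobiCn (modulus l) ψ ^ 4)) /
      (|l.α| * jacobiCn (modulus l) ψ ^ 2)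

/-- `ψ₀`, the elliptic coordinate of the initial covector (meaningful for `α ≠ 0`). -/
def psi₀ (l : Covector) : ℝ := Classical.epsilon (IsPhase l)

/-- `(K(k) - ψ₀)/æ` (meaningful for `α ≠ 0`). -/
def blowupTime (l : Covector) : ℝ := (ellipticK (modulus l) - psi₀ l) / ae l

open Classical in
/-- `t_sup`: `(K(k) - ψ₀)/æ` if `α ≠ 0`, and `+∞` if `α = 0`. -/
def tSup (l : Covector) : EReal := if l.α ≠ 0 then (blowupTime l : EReal) else ⊤

/-! ### The explicit formulas -/

/-- `ψ_t = ψ₀ + æ t`. -/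
def psi (l : Covector) (t : ℝ) : ℝ := psi₀ l + ae l * t

def genX₁ (l : Covector) (t : ℝ) : ℝ :=
  let k := modulus l;
  2 * ae l / |l.α| * (jacobiSc k (psi₀ l) * jacobiDn k (psi₀ l)
    - jacobiSc k (psi l t) * jacobiDn k (psi l t))

def genX₂ (l : Covector) (t : ℝ) : ℝ :=
  let k := modulus l;
  (4 * ae l * (ae l * (1 - k ^ 2) * t - (jacobiE k (psi l t) - jacobiE k (psi₀ l)))
    - |l.α| * genX₁ l t) / l.α

def genY (l : Covector) (t : ℝ) : ℝ :=
  let k := modulus l;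
  (-2 * ae l ^ 2) / (l.α * |l.α|) *
      (k ^ 2 * (jacobiCn k (psi l t) ^ 2 - jacobiCn k (psi₀ l) ^ 2)
        + (1 - k ^ 2) * (jacobiNc k (psi l t) ^ 2 - jacobiNc k (psi₀ l) ^ 2))
    + ae l / |l.α| * (jacobiDn k (psi₀ l) * jacobiSc k (psi₀ l)
        + jacobiDn k (psi l t) * jacobiSc k (psi l t)) * genX₂ l t

def genZ (l : Covector) (t : ℝ) : ℝ :=
  let k := modulus l;
  genX₂ l t ^ 3 / 6
    + 4 * ae l ^ 3 / (3 * l.α ^ 3) *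
      (2 * ae l * (k ^ 2 - 1) * t
        + (1 - k ^ 2) *
          (jacobiDn k (psi l t) * jacobiSn k (psi l t) / jacobiCn k (psi l t) ^ 3
            - jacobiDn k (psi₀ l) * jacobiSn k (psi₀ l) / jacobiCn k (psi₀ l) ^ 3)
        + k ^ 2 *
          (jacobiCn k (psi l t) * jacobiDn k (psi l t) * jacobiSn k (psi l t)
            - jacobiCn k (psi₀ l) * jacobiDn k (psi₀ l) * jacobiSn k (psi₀ l))
        - 2 * (jacobiE k (psi l t) - jacobiE k (psi₀ l)) * (2 * k ^ 2 - 1))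
    - 2 * ae l * jacobiDn k (psi₀ l) * jacobiSn k (psi₀ l) *
        (ae l * jacobiDn k (psi₀ l) * jacobiSc k (psi₀ l) / |l.α| * genX₂ l t
          - 1 / 2 * genX₁ l t * genX₂ l t - genY l t)
      / (jacobiCn k (psi₀ l) * |l.α|)
    - 2 * ae l ^ 2 * (2 * k ^ 2 - 1) * genX₁ l t / (3 * l.α * |l.α|)

/-- Case `α ≠ 0`. -/
def curveGeneral (l : Covector) (t : ℝ) : Fin 4 → ℝ :=
  ![genX₁ l t, genX₂ l t, genY l t, genZ l t]

/-- Case `α = 0`, `c ≠ 0`. -/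
def curveHyperbolic (l : Covector) (t : ℝ) : Fin 4 → ℝ :=
  ![(Real.sinh (l.θ - l.c * t) - Real.sinh l.θ) / l.c,
    (Real.cosh l.θ - Real.cosh (l.θ - l.c * t)) / l.c,
    (Real.sinh (l.c * t) - l.c * t) / (2 * l.c ^ 2),
    (4 * Real.sinh (l.c * t / 2) ^ 3 * Real.sinh (3 * l.θ - 3 * l.c * t / 2)
      - 3 * (Real.sinh (l.c * t) - l.c * t) * Real.sinh l.θ) / (6 * l.c ^ 3)]

/-- Case `α = 0`, `c = 0`. -/
def curveLine (l : Covector) (t : ℝ) : Fin 4 → ℝ :=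
  ![-(Real.cosh l.θ * t), Real.sinh l.θ * t, 0,
    (2 * Real.sinh l.θ ^ 2 + 1) * Real.sinh l.θ / 6 * t ^ 3]

open Classical in
def explicitCurve (l : Covector) : ℝ → Fin 4 → ℝ :=
  if l.α ≠ 0 then curveGeneral l else if l.c ≠ 0 then curveHyperbolic l else curveLine l

/-- Action on the base of the symmetry `h₁ ↦ -h₁`, `h₃ ↦ -h₃` of the Hamiltonian system. -/
def reflect (q : Fin 4 → ℝ) : Fin 4 → ℝ := ![-q 0, q 1, -q 2, q 3]

/-! ### The exponential map -/

/-- `N = {(l, t) ∈ C × ℝ₊ : t ∈ (0, t_sup(l))}`. -/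
def N : Set (Covector × ℝ) := {p | 0 < p.2 ∧ (p.2 : EReal) < tSup p.1}

open Classical in
/-- `Exp(l, t)` is the end point `q(t)` of the normal extremal on `[0, t]` which starts from the
origin with initial covector `l` (the value `0` is a dummy for the case that there is none). -/
def Exp (p : N) : Fin 4 → ℝ :=
  if h : ∃ (q ξ : ℝ → Fin 4 → ℝ), IsExtremalFrom p.1.1 q ξ (Icc 0 p.1.2) then
    h.choose p.1.2
  else 0

end Engel

end

namespace Engel

/-! ### Calculus of the Jacobi functions -/

section Jacobi

variable {k : ℝ}

/-! In the left-invariant frame the Hamiltonian system is triangular. The functions h₁, …, h₄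
satisfy a closed vertical system: h₄ = α and h₁² - h₂² = 1 are conserved, h₁ cannot change sign, and
θ' = -c, c' = -α cosh θ. Once θ is known, x₁ and x₂ are primitives of known functions of time, and
then so are y and z. Equality of two solutions therefore only needs the fact that equal derivatives
and equal initial values give equal functions (`eqOn_of_hasDerivWithinAt`).

For α ≠ 0 the energy E is conserved, so æ and k are constants of motion. The function sc·dn is an
increasing bijection of (-K, K) onto the line with differentiable inverse
(`exists_inverse_jacobiScDn`). Since c is a constant multiple of sc·dn ψ, it determines ψ; the
energy then gives sinh θ (`phase_energy`), and h₁ > 0 gives cosh θ (`phaseCosh_sq`). The derivative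
of sc·dn is proportional to cosh θ, so c' = -α cosh θ turns into ψ' = æ for every solution
(`IsVerticalCurve.phase`). As ψ stays in (-K, K), a solution must end before t_sup; conversely ψ₀ +
æt yields a solution up to t_sup.

It remains to differentiate the explicit curves (`isHorizontalCurve_curveGeneral` and its analogues
for α = 0). Near t_sup, p = sc·dn ψ_t tends to +∞ and the coordinates are polynomials in p with
convergent coefficients: x₁, x₂ and y have degree one, z has degree three, and the leading
coefficients have nonzero limits (`tendsto_abs_curveGeneral`). The case h₁ < 0 reduces to h₁ > 0 by
a reflection. -/

theorem modulus_radicand_pos (hk : k ∈ Ioo (0 : ℝ) 1) (t : ℝ) :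
    0 < 1 - k ^ 2 * Real.sin t ^ 2 := by
  have h1 : k ^ 2 < 1 := by nlinarith [hk.1, hk.2]
  nlinarith [Real.sin_sq_le_one t, sq_nonneg k, sq_nonneg (Real.sin t)]

theorem hasDerivAt_ellipticF (hk : k ∈ Ioo (0 : ℝ) 1) (φ : ℝ) :
    HasDerivAt (ellipticF k) (1 / Real.sqrt (1 - k ^ 2 * Real.sin φ ^ 2)) φ := by
  have hcont : Continuous fun t : ℝ => 1 / Real.sqrt (1 - k ^ 2 * Real.sin t ^ 2) :=
    continuous_const.div (by fun_prop) fun t => (Real.sqrt_pos.2 (modulus_radicand_pos hk t)).ne'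
  exact intervalIntegral.integral_hasDerivAt_right (hcont.intervalIntegrable _ _)
    (hcont.stronglyMeasurableAtFilter _ _) hcont.continuousAt

theorem strictMono_ellipticF (hk : k ∈ Ioo (0 : ℝ) 1) : StrictMono (ellipticF k) :=
  strictMono_of_hasDerivAt_pos (hasDerivAt_ellipticF hk) fun φ =>
    one_div_pos.2 (Real.sqrt_pos.2 (modulus_radicand_pos hk φ))

theorem ellipticF_neg (k φ : ℝ) : ellipticF k (-φ) = -ellipticF k φ := by
  unfold ellipticF
  have h := intervalIntegral.integral_comp_neg (a := 0) (b := φ)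
    (fun t : ℝ => 1 / Real.sqrt (1 - k ^ 2 * Real.sin t ^ 2))
  simp only [Real.sin_neg, neg_sq, neg_zero] at h
  rw [h, intervalIntegral.integral_symm]

theorem ellipticF_jacobiAm (hk : k ∈ Ioo (0 : ℝ) 1) (u : ℝ) :
    ellipticF k (jacobiAm k u) = u :=
  Function.rightInverse_invFun (ellipticF_bijective hk).2 u

theorem jacobiAm_ellipticF (hk : k ∈ Ioo (0 : ℝ) 1) (φ : ℝ) :
    jacobiAm k (ellipticF k φ) = φ :=
  Function.leftInverse_invFun (ellipticF_bijective hk).1 φ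

theorem strictMono_jacobiAm (hk : k ∈ Ioo (0 : ℝ) 1) : StrictMono (jacobiAm k) := by
  intro u v huv
  rwa [← (strictMono_ellipticF hk).lt_iff_lt, ellipticF_jacobiAm hk, ellipticF_jacobiAm hk]

theorem jacobiAm_neg (hk : k ∈ Ioo (0 : ℝ) 1) (u : ℝ) : jacobiAm k (-u) = -jacobiAm k u := by
  apply (ellipticF_bijective hk).1
  rw [ellipticF_neg, ellipticF_jacobiAm hk, ellipticF_jacobiAm hk]

/-- Inverse function rule: dn is the reciprocal of the integrand of F at am u. The continuity it
requires holds because a strictly increasing map onto the whole line is continuous. -/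
theorem hasDerivAt_jacobiAm (hk : k ∈ Ioo (0 : ℝ) 1) (u : ℝ) :
    HasDerivAt (jacobiAm k) (jacobiDn k u) u := by
  have hc : ContinuousAt (jacobiAm k) u := by
    refine ((strictMono_jacobiAm hk).strictMonoOn univ).continuousAt_of_image_mem_nhds
      univ_mem ?_
    exact mem_of_superset univ_mem fun φ _ => ⟨_, mem_univ _, jacobiAm_ellipticF hk φ⟩
  have h := (hasDerivAt_ellipticF hk (jacobiAm k u)).of_local_left_inverse hc
    (one_div_pos.2 (Real.sqrt_pos.2 (modulus_radicand_pos hk _))).ne'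
    (Eventually.of_forall (ellipticF_jacobiAm hk))
  simpa [jacobiDn, jacobiSn] using h

theorem jacobiDn_sq (hk : k ∈ Ioo (0 : ℝ) 1) (u : ℝ) :
    jacobiDn k u ^ 2 = 1 - k ^ 2 * jacobiSn k u ^ 2 :=
  Real.sq_sqrt (modulus_radicand_pos hk _).le

theorem jacobiDn_pos (hk : k ∈ Ioo (0 : ℝ) 1) (u : ℝ) : 0 < jacobiDn k u :=
  Real.sqrt_pos.2 (modulus_radicand_pos hk _)

theorem jacobiSn_sq (k u : ℝ) : jacobiSn k u ^ 2 = 1 - jacobiCn k u ^ 2 :=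
  Real.sin_sq _

theorem hasDerivAt_jacobiSn (hk : k ∈ Ioo (0 : ℝ) 1) (u : ℝ) :
    HasDerivAt (jacobiSn k) (jacobiCn k u * jacobiDn k u) u :=
  (hasDerivAt_jacobiAm hk u).sin

theorem hasDerivAt_jacobiCn (hk : k ∈ Ioo (0 : ℝ) 1) (u : ℝ) :
    HasDerivAt (jacobiCn k) (-(jacobiSn k u * jacobiDn k u)) u := by
  exact (hasDerivAt_jacobiAm hk u).cos.congr_deriv (by rw [neg_mul]; rfl)

theorem hasDerivAt_jacobiDn (hk : k ∈ Ioo (0 : ℝ) 1) (u : ℝ) :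
    HasDerivAt (jacobiDn k) (-(k ^ 2 * jacobiSn k u * jacobiCn k u)) u := by
  have h := ((((hasDerivAt_jacobiSn hk u).pow 2).const_mul (k ^ 2)).const_sub 1).sqrt
    (modulus_radicand_pos hk _).ne'
  refine h.congr_deriv ?_
  have := (jacobiDn_pos hk u).ne'
  change _ / (2 * jacobiDn k u) = _
  field_simp
  simp
  ring

theorem continuous_jacobiDn (hk : k ∈ Ioo (0 : ℝ) 1) : Continuous (jacobiDn k) :=
  continuous_iff_continuousAt.2 fun u => (hasDerivAt_jacobiDn hk u).continuousAt

theorem continuous_jacobiCn (hk : k ∈ Ioo (0 : ℝ) 1) : Continuous (jacobiCn k) :=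
  continuous_iff_continuousAt.2 fun u => (hasDerivAt_jacobiCn hk u).continuousAt

theorem continuous_jacobiSn (hk : k ∈ Ioo (0 : ℝ) 1) : Continuous (jacobiSn k) :=
  continuous_iff_continuousAt.2 fun u => (hasDerivAt_jacobiSn hk u).continuousAt

theorem hasDerivAt_jacobiE (hk : k ∈ Ioo (0 : ℝ) 1) (u : ℝ) :
    HasDerivAt (jacobiE k) (jacobiDn k u ^ 2) u := by
  have hc : Continuous fun t => jacobiDn k t ^ 2 := (continuous_jacobiDn hk).pow 2
  exact intervalIntegral.integral_hasDerivAt_right (hc.intervalIntegrable _ _)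
    (hc.stronglyMeasurableAtFilter _ _) hc.continuousAt

theorem jacobiAm_ellipticK (hk : k ∈ Ioo (0 : ℝ) 1) : jacobiAm k (ellipticK k) = Real.pi / 2 :=
  jacobiAm_ellipticF hk _

theorem ellipticK_pos (hk : k ∈ Ioo (0 : ℝ) 1) : 0 < ellipticK k := by
  have h : ellipticF k 0 = 0 := by simp [ellipticF]
  rw [← h]
  exact strictMono_ellipticF hk (by positivity)

theorem jacobiCn_pos (hk : k ∈ Ioo (0 : ℝ) 1) {u : ℝ}
    (hu : u ∈ Ioo (-ellipticK k) (ellipticK k)) : 0 < jacobiCn k u := by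
  apply Real.cos_pos_of_mem_Ioo
  have h1 := strictMono_jacobiAm hk hu.1
  have h2 := strictMono_jacobiAm hk hu.2
  rw [jacobiAm_neg hk, jacobiAm_ellipticK hk] at h1
  rw [jacobiAm_ellipticK hk] at h2
  exact ⟨h1, h2⟩

/-! ### The function `sc · dn` and its inverse -/

/-- The function `sc · dn`, a bijection of `(-K, K)` onto the line. -/
noncomputable def jacobiScDn (k u : ℝ) : ℝ := jacobiSc k u * jacobiDn k u

theorem jacobiScDn_neg (hk : k ∈ Ioo (0 : ℝ) 1) (u : ℝ) :
    jacobiScDn k (-u) = -jacobiScDn k u := by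
  simp [jacobiScDn, jacobiSc, jacobiDn, jacobiSn, jacobiCn, jacobiAm_neg hk, neg_div]

/-- This quotient is the derivative of sc·dn and, up to the factor 2æ²/|α|, equals cosh θ. -/
theorem jacobiScDn_deriv_pos (hk : k ∈ Ioo (0 : ℝ) 1) {u : ℝ} (hu : 0 < jacobiCn k u) :
    0 < (1 - k ^ 2 * (1 - jacobiCn k u ^ 4)) / jacobiCn k u ^ 2 := by
  have h1 : k ^ 2 < 1 := by nlinarith [hk.1, hk.2]
  have : 0 < k ^ 2 * jacobiCn k u ^ 4 := by have := hk.1; positivity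
  exact div_pos (by linarith) (by positivity)

theorem hasDerivAt_jacobiScDn (hk : k ∈ Ioo (0 : ℝ) 1) {u : ℝ} (hu : jacobiCn k u ≠ 0) :
    HasDerivAt (jacobiScDn k) ((1 - k ^ 2 * (1 - jacobiCn k u ^ 4)) / jacobiCn k u ^ 2) u := by
  refine (((hasDerivAt_jacobiSn hk u).div (hasDerivAt_jacobiCn hk u) hu).mul
    (hasDerivAt_jacobiDn hk u)).congr_deriv ?_
  field_simp
  simp only [Pi.div_apply]
  field_simp
  linear_combination (jacobiCn k u ^ 2 + jacobiSn k u ^ 2) * jacobiDn_sq hk u +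
    (1 - 2 * k ^ 2 * jacobiCn k u ^ 2 - k ^ 2 * jacobiSn k u ^ 2 -
      k ^ 2 * (1 - jacobiCn k u ^ 2)) * jacobiSn_sq k u

theorem strictMonoOn_jacobiScDn (hk : k ∈ Ioo (0 : ℝ) 1) :
    StrictMonoOn (jacobiScDn k) (Ioo (-ellipticK k) (ellipticK k)) := by
  refine strictMonoOn_of_deriv_pos (convex_Ioo _ _) (fun u hu =>
    (hasDerivAt_jacobiScDn hk (jacobiCn_pos hk hu).ne').continuousAt.continuousWithinAt) ?_
  intro u hu
  rw [interior_Ioo] at hu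
  rw [(hasDerivAt_jacobiScDn hk (jacobiCn_pos hk hu).ne').deriv]
  exact jacobiScDn_deriv_pos hk (jacobiCn_pos hk hu)

/-- The numerator sn·dn tends to dn K > 0 while cn tends to 0 from above. -/
theorem tendsto_jacobiScDn (hk : k ∈ Ioo (0 : ℝ) 1) :
    Tendsto (jacobiScDn k) (𝓝[<] ellipticK k) atTop := by
  have hs : Tendsto (fun u => jacobiSn k u * jacobiDn k u) (𝓝[<] ellipticK k)
      (𝓝 (jacobiDn k (ellipticK k))) := by
    have h := ((continuous_jacobiSn hk).mul (continuous_jacobiDn hk)).tendsto (ellipticK k)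
    have h1 : jacobiSn k (ellipticK k) = 1 := by simp [jacobiSn, jacobiAm_ellipticK hk]
    simp only [Pi.mul_apply, h1, one_mul] at h
    exact h.mono_left nhdsWithin_le_nhds
  have hc : Tendsto (jacobiCn k) (𝓝[<] ellipticK k) (𝓝[>] 0) := by
    refine tendsto_nhdsWithin_iff.2 ⟨?_, ?_⟩
    · have h := (continuous_jacobiCn hk).tendsto (ellipticK k)
      have h1 : jacobiCn k (ellipticK k) = 0 := by simp [jacobiCn, jacobiAm_ellipticK hk]
      rw [h1] at h
      exact h.mono_left nhdsWithin_le_nhds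
    · have := ellipticK_pos hk
      filter_upwards [Ioo_mem_nhdsLT (show -ellipticK k < ellipticK k by linarith)] with u hu
      exact jacobiCn_pos hk hu
  refine (hs.pos_mul_atTop (jacobiDn_pos hk _) hc.inv_tendsto_nhdsGT_zero).congr fun u => ?_
  simp only [jacobiScDn, jacobiSc, Pi.inv_apply]
  ring

theorem surjOn_jacobiScDn (hk : k ∈ Ioo (0 : ℝ) 1) :
    SurjOn (jacobiScDn k) (Ioo (-ellipticK k) (ellipticK k)) univ := by
  have hK : -ellipticK k < ellipticK k := by linarith [ellipticK_pos hk]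
  have hbot : Tendsto (jacobiScDn k) (𝓝[>] (-ellipticK k)) atBot := by
    have h : Tendsto (fun u : ℝ => -u) (𝓝[>] (-ellipticK k)) (𝓝[<] ellipticK k) := by
      simpa using tendsto_neg_nhdsGT_neg (a := ellipticK k)
    refine (tendsto_neg_atTop_atBot.comp ((tendsto_jacobiScDn hk).comp h)).congr fun u => ?_
    simp [jacobiScDn_neg hk]
  exact isPreconnected_Ioo.intermediate_value_Iii
    (le_principal_iff.2 (Ioo_mem_nhdsGT hK)) (le_principal_iff.2 (Ioo_mem_nhdsLT hK))
    (fun u hu =>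
      (hasDerivAt_jacobiScDn hk (jacobiCn_pos hk hu).ne').continuousAt.continuousWithinAt)
    hbot (tendsto_jacobiScDn hk)

/-- The inverse of `sc · dn` with values in `(-K, K)` is differentiable. -/
theorem exists_inverse_jacobiScDn (hk : k ∈ Ioo (0 : ℝ) 1) : ∃ Q : ℝ → ℝ,
    (∀ v, Q v ∈ Ioo (-ellipticK k) (ellipticK k)) ∧ (∀ v, jacobiScDn k (Q v) = v) ∧
    (∀ u ∈ Ioo (-ellipticK k) (ellipticK k), Q (jacobiScDn k u) = u) ∧
    ∀ v, HasDerivAt Q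
      ((1 - k ^ 2 * (1 - jacobiCn k (Q v) ^ 4)) / jacobiCn k (Q v) ^ 2)⁻¹ v := by
  choose Q hQ hPQ using fun v => surjOn_jacobiScDn hk (mem_univ v)
  have hleft : ∀ u ∈ Ioo (-ellipticK k) (ellipticK k), Q (jacobiScDn k u) = u := fun u hu =>
    (strictMonoOn_jacobiScDn hk).injOn (hQ _) hu (hPQ _)
  have hmono : StrictMono Q := fun v w hvw => by
    rwa [← (strictMonoOn_jacobiScDn hk).lt_iff_lt (hQ v) (hQ w), hPQ, hPQ]
  refine ⟨Q, hQ, hPQ, hleft, fun v => ?_⟩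
  have hc : ContinuousAt Q v := by
    refine (hmono.strictMonoOn univ).continuousAt_of_image_mem_nhds univ_mem ?_
    -- The range of the increasing map Q contains the open interval (-K, K), a neighbourhood of Q v;
    -- hence Q is continuous at v.
    exact mem_of_superset (isOpen_Ioo.mem_nhds (hQ v)) fun u hu => ⟨_, mem_univ _, hleft u hu⟩
  exact (hasDerivAt_jacobiScDn hk (jacobiCn_pos hk (hQ v)).ne').of_local_left_inverse hc
    (jacobiScDn_deriv_pos hk (jacobiCn_pos hk (hQ v))).ne' (Eventually.of_forall hPQ)

end Jacobi

end Engel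

namespace Engel

/-! ### Hamilton's equations in the left-invariant frame -/

theorem h₁_eq (q ξ : Fin 4 → ℝ) : h₁ q ξ = ξ 0 - ξ 2 * q 1 / 2 := by
  simp [h₁, pairing, X₁, Fin.sum_univ_four]; ring

theorem h₂_eq (q ξ : Fin 4 → ℝ) :
    h₂ q ξ = ξ 1 + ξ 2 * q 0 / 2 + ξ 3 * (q 0 ^ 2 + q 1 ^ 2) / 2 := by
  simp [h₂, pairing, X₂, Fin.sum_univ_four]; ring

theorem h₃_eq (q ξ : Fin 4 → ℝ) : h₃ q ξ = ξ 2 + ξ 3 * q 0 := by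
  simp [h₃, pairing, X₃, Fin.sum_univ_four]

theorem h₄_eq (q ξ : Fin 4 → ℝ) : h₄ q ξ = ξ 3 := by
  simp [h₄, pairing, X₄, Fin.sum_univ_four]

/-- As a function of any single coordinate of q or ξ, h₁ is affine and h₂ is at most quadratic, so
this one computation serves all eight partial derivatives of H. -/
theorem deriv_half_sq_sub_sq {F : ℝ → ℝ} (a b a' b' c' x : ℝ)
    (hF : ∀ s, F s = (-(a + b * s) ^ 2 + (a' + b' * s + c' * s ^ 2) ^ 2) / 2) :
    deriv F x = -((a + b * x) * b) + (a' + b' * x + c' * x ^ 2) * (b' + 2 * c' * x) := by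
  obtain rfl : F = _ := funext hF
  have hx := hasDerivAt_id x
  have h1 := (hx.const_mul b).const_add a
  have h2 := ((hx.const_mul b').const_add a').add ((hx.pow 2).const_mul c')
  refine (((h1.pow 2).neg.add (h2.pow 2)).div_const 2).deriv.trans ?_
  simp
  ring

theorem dHdξ_zero (q ξ : Fin 4 → ℝ) : dHdξ q ξ 0 = -h₁ q ξ := by
  unfold dHdξ
  rw [deriv_half_sq_sub_sq (-(ξ 2 * q 1 / 2)) 1 (h₂ q ξ) 0 0, h₁_eq]
  · ring
  · intro s
    simp [hamiltonian, h₁_eq, h₂_eq, Function.update]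
    ring

theorem dHdξ_one (q ξ : Fin 4 → ℝ) : dHdξ q ξ 1 = h₂ q ξ := by
  unfold dHdξ
  rw [deriv_half_sq_sub_sq (h₁ q ξ) 0 (ξ 2 * q 0 / 2 + ξ 3 * (q 0 ^ 2 + q 1 ^ 2) / 2) 1 0, h₂_eq]
  · ring
  · intro s
    simp [hamiltonian, h₁_eq, h₂_eq, Function.update]
    ring

theorem dHdξ_two (q ξ : Fin 4 → ℝ) :
    dHdξ q ξ 2 = (h₁ q ξ * q 1 + h₂ q ξ * q 0) / 2 := by
  unfold dHdξ
  rw [deriv_half_sq_sub_sq (ξ 0) (-(q 1 / 2)) (ξ 1 + ξ 3 * (q 0 ^ 2 + q 1 ^ 2) / 2) (q 0 / 2) 0,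
    h₁_eq, h₂_eq]
  · ring
  · intro s
    simp [hamiltonian, h₁_eq, h₂_eq, Function.update]
    ring

theorem dHdξ_three (q ξ : Fin 4 → ℝ) :
    dHdξ q ξ 3 = h₂ q ξ * (q 0 ^ 2 + q 1 ^ 2) / 2 := by
  unfold dHdξ
  rw [deriv_half_sq_sub_sq (h₁ q ξ) 0 (ξ 1 + ξ 2 * q 0 / 2) ((q 0 ^ 2 + q 1 ^ 2) / 2) 0, h₂_eq]
  · ring
  · intro s
    simp [hamiltonian, h₁_eq, h₂_eq, Function.update]
    ring

theorem dHdq_zero (q ξ : Fin 4 → ℝ) : dHdq q ξ 0 = h₂ q ξ * (ξ 2 / 2 + ξ 3 * q 0) := by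
  unfold dHdq
  rw [deriv_half_sq_sub_sq (h₁ q ξ) 0 (ξ 1 + ξ 3 * q 1 ^ 2 / 2) (ξ 2 / 2) (ξ 3 / 2), h₂_eq]
  · ring
  · intro s
    simp [hamiltonian, h₁_eq, h₂_eq, Function.update]
    ring

theorem dHdq_one (q ξ : Fin 4 → ℝ) :
    dHdq q ξ 1 = h₁ q ξ * ξ 2 / 2 + h₂ q ξ * (ξ 3 * q 1) := by
  unfold dHdq
  rw [deriv_half_sq_sub_sq (ξ 0) (-(ξ 2 / 2)) (ξ 1 + ξ 2 * q 0 / 2 + ξ 3 * q 0 ^ 2 / 2) 0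
    (ξ 3 / 2), h₁_eq, h₂_eq]
  · ring
  · intro s
    simp [hamiltonian, h₁_eq, h₂_eq, Function.update]
    ring

theorem dHdq_two (q ξ : Fin 4 → ℝ) : dHdq q ξ 2 = 0 := by
  unfold dHdq
  rw [deriv_half_sq_sub_sq (h₁ q ξ) 0 (h₂ q ξ) 0 0]
  · ring
  · intro s
    simp [hamiltonian, h₁_eq, h₂_eq, Function.update]

theorem dHdq_three (q ξ : Fin 4 → ℝ) : dHdq q ξ 3 = 0 := by
  unfold dHdq
  rw [deriv_half_sq_sub_sq (h₁ q ξ) 0 (h₂ q ξ) 0 0]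
  · ring
  · intro s
    simp [hamiltonian, h₁_eq, h₂_eq, Function.update]

/-- `q` is a curve with velocity `-cosh θ X₁ + sinh θ X₂`. -/
structure IsHorizontalCurve (q : ℝ → Fin 4 → ℝ) (θ : ℝ → ℝ) (s : Set ℝ) : Prop where
  x₁ : ∀ t ∈ s, HasDerivWithinAt (fun τ => q τ 0) (-Real.cosh (θ t)) s t
  x₂ : ∀ t ∈ s, HasDerivWithinAt (fun τ => q τ 1) (Real.sinh (θ t)) s t
  y : ∀ t ∈ s, HasDerivWithinAt (fun τ => q τ 2)
    ((Real.cosh (θ t) * q t 1 + Real.sinh (θ t) * q t 0) / 2) s t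
  z : ∀ t ∈ s, HasDerivWithinAt (fun τ => q τ 3)
    (Real.sinh (θ t) * (q t 0 ^ 2 + q t 1 ^ 2) / 2) s t

/-- The vertical subsystem of Hamilton's equations on the level `H = -1/2`, `h₁ > 0`. -/
structure IsVerticalCurve (α : ℝ) (θ c : ℝ → ℝ) (s : Set ℝ) : Prop where
  θ_eq : ∀ t ∈ s, HasDerivWithinAt θ (-c t) s t
  c_eq : ∀ t ∈ s, HasDerivWithinAt c (-(α * Real.cosh (θ t))) s t

/-- The only uniqueness principle in the proof; it also yields conservation laws, with g constant
and f' = 0. No regularity of f' is needed, since right derivatives on [0, T) and continuity on [0,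
T] suffice. -/
theorem eqOn_of_hasDerivWithinAt {f g f' : ℝ → ℝ} {T : ℝ}
    (hf : ∀ t ∈ Icc 0 T, HasDerivWithinAt f (f' t) (Icc 0 T) t)
    (hg : ∀ t ∈ Icc 0 T, HasDerivWithinAt g (f' t) (Icc 0 T) t) (h0 : f 0 = g 0) :
    ∀ t ∈ Icc 0 T, f t = g t := by
  have key : ∀ {u : ℝ → ℝ}, (∀ t ∈ Icc 0 T, HasDerivWithinAt u (f' t) (Icc 0 T) t) →
      ContinuousOn u (Icc 0 T) ∧ ∀ t ∈ Ico 0 T, HasDerivWithinAt u (f' t) (Ici t) t :=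
    fun hu => ⟨fun t ht => (hu t ht).continuousWithinAt, fun t ht =>
      (hu t (Ico_subset_Icc_self ht)).mono_of_mem_nhdsWithin
        (mem_of_superset (Icc_mem_nhdsGE ht.2) (Icc_subset_Icc_left ht.1))⟩
  exact eq_of_has_deriv_right_eq (key hf).2 (key hg).2 (key hf).1 (key hg).1 h0

/-- The system is triangular: θ fixes the velocities of x₁ and x₂, and these coordinates then fix
the velocities of y and z. -/
theorem IsHorizontalCurve.eqOn {p q : ℝ → Fin 4 → ℝ} {θ : ℝ → ℝ} {T : ℝ}
    (hp : IsHorizontalCurve p θ (Icc 0 T)) (hq : IsHorizontalCurve q θ (Icc 0 T))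
    (h0 : p 0 = q 0) : ∀ t ∈ Icc 0 T, p t = q t := by
  have e0 := eqOn_of_hasDerivWithinAt hp.x₁ hq.x₁ (congrFun h0 0)
  have e1 := eqOn_of_hasDerivWithinAt hp.x₂ hq.x₂ (congrFun h0 1)
  have e2 := eqOn_of_hasDerivWithinAt hp.y
    (fun t ht => by rw [e0 t ht, e1 t ht]; exact hq.y t ht) (congrFun h0 2)
  have e3 := eqOn_of_hasDerivWithinAt hp.z
    (fun t ht => by rw [e0 t ht, e1 t ht]; exact hq.z t ht) (congrFun h0 3)
  intro t ht
  ext i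
  fin_cases i
  exacts [e0 t ht, e1 t ht, e2 t ht, e3 t ht]

theorem IsHorizontalCurve.congr {q : ℝ → Fin 4 → ℝ} {θ θ' : ℝ → ℝ} {s : Set ℝ}
    (h : IsHorizontalCurve q θ s) (hθ : ∀ t ∈ s, θ t = θ' t) : IsHorizontalCurve q θ' s where
  x₁ t ht := hθ t ht ▸ h.x₁ t ht
  x₂ t ht := hθ t ht ▸ h.x₂ t ht
  y t ht := hθ t ht ▸ h.y t ht
  z t ht := hθ t ht ▸ h.z t ht

theorem IsHorizontalCurve.mono {q : ℝ → Fin 4 → ℝ} {θ : ℝ → ℝ} {s s' : Set ℝ}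
    (h : IsHorizontalCurve q θ s) (hs : s' ⊆ s) : IsHorizontalCurve q θ s' where
  x₁ t ht := (h.x₁ t (hs ht)).mono hs
  x₂ t ht := (h.x₂ t (hs ht)).mono hs
  y t ht := (h.y t (hs ht)).mono hs
  z t ht := (h.z t (hs ht)).mono hs

theorem IsNormalExtremal.mono {q ξ : ℝ → Fin 4 → ℝ} {s s' : Set ℝ}
    (h : IsNormalExtremal q ξ s) (hs : s' ⊆ s) : IsNormalExtremal q ξ s' where
  q_eq t ht i := (h.q_eq t (hs ht) i).mono hs
  ξ_eq t ht i := (h.ξ_eq t (hs ht) i).mono hs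

/-- A horizontal curve over a solution of the vertical subsystem lifts to a normal extremal. -/
theorem exists_isNormalExtremal {q : ℝ → Fin 4 → ℝ} {θ c : ℝ → ℝ} {α : ℝ} {s : Set ℝ}
    (hq : IsHorizontalCurve q θ s) (hv : IsVerticalCurve α θ c s) :
    ∃ ξ : ℝ → Fin 4 → ℝ, IsNormalExtremal q ξ s ∧
      ∀ t, HasCoords (q t) (ξ t) ⟨θ t, c t, α⟩ := by
  -- Solve h₁ = cosh θ, h₂ = sinh θ, h₃ = c, h₄ = α for ξ, starting from the last component.
  let ξ : ℝ → Fin 4 → ℝ := fun t =>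
    ![Real.cosh (θ t) + (c t - α * q t 0) * q t 1 / 2,
      Real.sinh (θ t) - (c t - α * q t 0) * q t 0 / 2 - α * (q t 0 ^ 2 + q t 1 ^ 2) / 2,
      c t - α * q t 0, α]
  have hξ : ∀ t, HasCoords (q t) (ξ t) ⟨θ t, c t, α⟩ := by
    intro t
    refine ⟨?_, ?_, ?_, ?_⟩
    · simp [h₁_eq, ξ]
    · simp [h₂_eq, ξ]; ring
    · simp [h₃_eq, ξ]
    · simp [h₄_eq, ξ]
  refine ⟨ξ, ⟨fun t ht i => ?_, fun t ht i => ?_⟩, hξ⟩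
  · obtain ⟨e1, e2, -, -⟩ := hξ t
    fin_cases i
    · simpa [dHdξ_zero, e1] using hq.x₁ t ht
    · simpa [dHdξ_one, e2] using hq.x₂ t ht
    · simpa [dHdξ_two, e1, e2] using hq.y t ht
    · simpa [dHdξ_three, e2] using hq.z t ht
  · obtain ⟨e1, e2, -, -⟩ := hξ t
    have d0 := hq.x₁ t ht
    have d1 := hq.x₂ t ht
    have dc := hv.c_eq t ht
    have dθ := hv.θ_eq t ht
    have d2 := dc.sub (d0.const_mul α)
    have ds := (((d0.pow 2).add (d1.pow 2)).const_mul α).div_const 2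
    fin_cases i
    · change HasDerivWithinAt _ (-dHdq _ _ 0) s t
      rw [dHdq_zero, e2]
      refine (dθ.cosh.add ((d2.mul d1).div_const 2)).congr_deriv ?_
      simp [ξ]; ring
    · change HasDerivWithinAt _ (-dHdq _ _ 1) s t
      rw [dHdq_one, e1, e2]
      refine ((dθ.sinh.sub ((d2.mul d0).div_const 2)).sub ds).congr_deriv ?_
      simp [ξ]; ring
    · change HasDerivWithinAt _ (-dHdq _ _ 2) s t
      rw [dHdq_two]
      refine d2.congr_deriv ?_
      ring
    · change HasDerivWithinAt _ (-dHdq _ _ 3) s t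
      rw [dHdq_three, neg_zero]
      exact hasDerivWithinAt_const t s α

/-- The right-hand sides encode the brackets [X₁, X₂] = X₃ and [X₁, X₃] = X₄, all others being zero.
-/
theorem IsNormalExtremal.hasDerivWithinAt_frame {q ξ : ℝ → Fin 4 → ℝ} {s : Set ℝ}
    (h : IsNormalExtremal q ξ s) {t : ℝ} (ht : t ∈ s) :
    HasDerivWithinAt (fun τ => h₁ (q τ) (ξ τ)) (-(h₂ (q t) (ξ t) * h₃ (q t) (ξ t))) s t ∧
    HasDerivWithinAt (fun τ => h₂ (q τ) (ξ τ)) (-(h₁ (q t) (ξ t) * h₃ (q t) (ξ t))) s t ∧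
    HasDerivWithinAt (fun τ => h₃ (q τ) (ξ τ)) (-(h₄ (q t) (ξ t) * h₁ (q t) (ξ t))) s t ∧
    HasDerivWithinAt (fun τ => h₄ (q τ) (ξ τ)) 0 s t := by
  have q0 := h.q_eq t ht 0
  have q1 := h.q_eq t ht 1
  have p0 := h.ξ_eq t ht 0
  have p1 := h.ξ_eq t ht 1
  have p2 := h.ξ_eq t ht 2
  have p3 := h.ξ_eq t ht 3
  rw [dHdξ_zero] at q0
  rw [dHdξ_one] at q1
  rw [dHdq_zero] at p0
  rw [dHdq_one] at p1
  rw [dHdq_two, neg_zero] at p2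
  rw [dHdq_three, neg_zero] at p3
  refine ⟨?_, ?_, ?_, ?_⟩
  · simp only [h₁_eq _ (ξ _)]
    refine (p0.sub ((p2.mul q1).div_const 2)).congr_deriv ?_
    simp only [h₃_eq]; ring
  · simp only [h₂_eq _ (ξ _)]
    refine ((p1.add ((p2.mul q0).div_const 2)).add
      ((p3.mul ((q0.pow 2).add (q1.pow 2))).div_const 2)).congr_deriv ?_
    simp [h₃_eq, h₁_eq, h₂_eq]; ring
  · simp only [h₃_eq _ (ξ _)]
    refine (p2.add (p3.mul q0)).congr_deriv ?_
    simp only [h₄_eq]; ring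
  · simpa only [h₄_eq _ (ξ _)] using p3

/-- Along an extremal with initial covector `l` the vertical part stays in the chart `(θ, c, α)`
and solves the vertical subsystem. -/
theorem IsExtremalFrom.exists_coords {l : Covector} {q ξ : ℝ → Fin 4 → ℝ} {T : ℝ} (hT : 0 ≤ T)
    (h : IsExtremalFrom l q ξ (Icc 0 T)) :
    ∃ θ c : ℝ → ℝ, θ 0 = l.θ ∧ c 0 = l.c ∧
      (∀ t ∈ Icc 0 T, HasCoords (q t) (ξ t) ⟨θ t, c t, l.α⟩) ∧
      IsVerticalCurve l.α θ c (Icc 0 T) ∧ IsHorizontalCurve q θ (Icc 0 T) := by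
  obtain ⟨hN, hq0, i1, i2, i3, i4⟩ := h
  have h0 : (0 : ℝ) ∈ Icc 0 T := ⟨le_rfl, hT⟩
  have e4 : ∀ t ∈ Icc 0 T, h₄ (q t) (ξ t) = l.α :=
    eqOn_of_hasDerivWithinAt (g := fun _ => l.α) (fun t ht => (hN.hasDerivWithinAt_frame ht).2.2.2)
      (fun t _ => hasDerivWithinAt_const t _ _) i4
  have eH : ∀ t ∈ Icc 0 T, h₁ (q t) (ξ t) ^ 2 - h₂ (q t) (ξ t) ^ 2 = 1 := by
    refine eqOn_of_hasDerivWithinAt (g := fun _ => 1) (f' := fun _ => 0) (fun t ht => ?_)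
      (fun t _ => hasDerivWithinAt_const t _ _) ?_
    · obtain ⟨d1, d2, -, -⟩ := hN.hasDerivWithinAt_frame ht
      refine ((d1.pow 2).sub (d2.pow 2)).congr_deriv ?_
      ring
    · simp only [i1, i2]
      exact Real.cosh_sq_sub_sinh_sq _
  -- Since h₁² = 1 + h₂² excludes zeros of h₁, the intermediate value theorem preserves the initial
  -- sign.
  have hpos : ∀ t ∈ Icc 0 T, 0 < h₁ (q t) (ξ t) := by
    intro t ht
    by_contra hneg
    have hc : ContinuousOn (fun τ => h₁ (q τ) (ξ τ)) (Icc 0 t) := fun τ hτ =>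
      ((hN.hasDerivWithinAt_frame ⟨hτ.1, hτ.2.trans ht.2⟩).1.continuousWithinAt).mono
        (Icc_subset_Icc_right ht.2)
    obtain ⟨τ, hτ, hz⟩ := intermediate_value_Icc' ht.1 hc
      (show (0 : ℝ) ∈ _ from ⟨not_lt.1 hneg, by simp only [i1]; exact (Real.cosh_pos _).le⟩)
    have := eH τ ⟨hτ.1, hτ.2.trans ht.2⟩
    simp only at hz
    rw [hz] at this
    nlinarith [sq_nonneg (h₂ (q τ) (ξ τ))]
  have e1 : ∀ t ∈ Icc 0 T,
      h₁ (q t) (ξ t) = Real.cosh (Real.arsinh (h₂ (q t) (ξ t))) := by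
    intro t ht
    rw [Real.cosh_arsinh, eq_comm, Real.sqrt_eq_iff_mul_self_eq_of_pos (hpos t ht)]
    linarith [eH t ht]
  refine ⟨fun t => Real.arsinh (h₂ (q t) (ξ t)), fun t => h₃ (q t) (ξ t), ?_, i3, ?_,
    ⟨?_, ?_⟩, ⟨?_, ?_, ?_, ?_⟩⟩
  · simp only [i2, Real.arsinh_sinh]
  · exact fun t ht => ⟨e1 t ht, (Real.sinh_arsinh _).symm, rfl, e4 t ht⟩
  · intro t ht
    refine ((hN.hasDerivWithinAt_frame ht).2.1.arsinh).congr_deriv ?_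
    rw [← Real.cosh_arsinh, ← e1 t ht]
    have := (hpos t ht).ne'
    simp only [smul_eq_mul]
    field_simp
  · intro t ht
    refine (hN.hasDerivWithinAt_frame ht).2.2.1.congr_deriv ?_
    rw [e4 t ht, ← e1 t ht]
  · intro t ht
    rw [← e1 t ht, ← dHdξ_zero]
    exact hN.q_eq t ht 0
  · intro t ht
    rw [Real.sinh_arsinh, ← dHdξ_one]
    exact hN.q_eq t ht 1
  · intro t ht
    rw [← e1 t ht, Real.sinh_arsinh, ← dHdξ_two]
    exact hN.q_eq t ht 2
  · intro t ht
    rw [Real.sinh_arsinh, ← dHdξ_three]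
    exact hN.q_eq t ht 3

/-! ### The reflection exchanging the two signs of h₁ -/

theorem h₁_reflect (q ξ : Fin 4 → ℝ) : h₁ (reflect q) (reflect ξ) = -h₁ q ξ := by
  simp [h₁_eq, reflect]; ring

theorem h₂_reflect (q ξ : Fin 4 → ℝ) : h₂ (reflect q) (reflect ξ) = h₂ q ξ := by
  simp [h₂_eq, reflect]

/-- The symmetry `h₁ ↦ -h₁`, `h₃ ↦ -h₃` of the Hamiltonian system. -/
theorem IsNormalExtremal.reflect {q ξ : ℝ → Fin 4 → ℝ} {s : Set ℝ} (h : IsNormalExtremal q ξ s) :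
    IsNormalExtremal (fun t => reflect (q t)) (fun t => reflect (ξ t)) s := by
  refine ⟨fun t ht i => ?_, fun t ht i => ?_⟩
  · have hi := h.q_eq t ht i
    fin_cases i
    · simp [dHdξ_zero, h₁_reflect] at hi ⊢
      exact hi.neg.congr_deriv (by simp)
    · simp [dHdξ_one, h₂_reflect] at hi ⊢
      simpa [Engel.reflect] using hi
    · simp [dHdξ_two, h₁_reflect, h₂_reflect] at hi ⊢
      refine hi.neg.congr_deriv ?_
      simp [Engel.reflect]; ring
    · simp [dHdξ_three, h₂_reflect] at hi ⊢
      simpa [Engel.reflect] using hi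
  · have hi := h.ξ_eq t ht i
    fin_cases i
    · simp [dHdq_zero, h₂_reflect] at hi ⊢
      refine hi.neg.congr_deriv ?_
      simp [Engel.reflect]; ring
    · simp [dHdq_one, h₁_reflect, h₂_reflect] at hi ⊢
      refine hi.congr_deriv ?_
      simp [Engel.reflect]
    · simp [dHdq_two] at hi ⊢
      exact hi.neg.congr_deriv (by simp)
    · simp [dHdq_three] at hi ⊢
      simpa [Engel.reflect] using hi

end Engel

namespace Engel

/-! ### Elliptic coordinates -/

theorem sign_eq_div_abs {α : ℝ} (hα : α ≠ 0) : Real.sign α = α / |α| := by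
  rcases lt_or_gt_of_ne hα with h | h
  · rw [Real.sign_of_neg h, abs_of_neg h]; field_simp
  · rw [Real.sign_of_pos h, abs_of_pos h]; field_simp

section Elliptic

variable {l : Covector}

theorem ae_sq (l : Covector) : 2 * ae l ^ 2 = Real.sqrt (energy l ^ 2 + l.α ^ 2) := by
  rw [ae, Real.sq_sqrt (by positivity)]
  ring

theorem ae_pos (hα : l.α ≠ 0) : 0 < ae l := by
  have : 0 < l.α ^ 2 := by positivity
  exact Real.sqrt_pos.2 (div_pos (Real.sqrt_pos.2 (by nlinarith [sq_nonneg (energy l)])) two_pos)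

/-- Strictness comes from α ≠ 0 and is what keeps the modulus away from 0 and 1. -/
theorem abs_energy_lt (hα : l.α ≠ 0) : |energy l| < 2 * ae l ^ 2 := by
  have : 0 < l.α ^ 2 := by positivity
  rw [ae_sq, ← Real.sqrt_sq_eq_abs]
  exact Real.sqrt_lt_sqrt (sq_nonneg _) (by linarith)

theorem modulus_sq (hα : l.α ≠ 0) : modulus l ^ 2 = 1 / 2 + energy l / (4 * ae l ^ 2) := by
  have h := abs_lt.1 (abs_energy_lt hα)
  have := ae_pos hα
  refine Real.sq_sqrt ?_
  rw [div_add_div _ _ two_ne_zero (by positivity)]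
  exact div_nonneg (by linarith [h.1]) (by positivity)

theorem energy_eq (hα : l.α ≠ 0) : energy l = 2 * ae l ^ 2 * (2 * modulus l ^ 2 - 1) := by
  have := (ae_pos hα).ne'
  rw [modulus_sq hα]
  field_simp
  ring

theorem alpha_sq (hα : l.α ≠ 0) :
    l.α ^ 2 = 16 * ae l ^ 4 * modulus l ^ 2 * (1 - modulus l ^ 2) := by
  have h : (2 * ae l ^ 2) ^ 2 = energy l ^ 2 + l.α ^ 2 := by
    rw [ae_sq, Real.sq_sqrt (by positivity)]
  rw [energy_eq hα] at h
  linear_combination -h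

theorem modulus_mem (hα : l.α ≠ 0) : modulus l ∈ Ioo (0 : ℝ) 1 := by
  have h := abs_lt.1 (abs_energy_lt hα)
  have := ae_pos hα
  have h0 : 0 ≤ modulus l := Real.sqrt_nonneg _
  have e := energy_eq hα
  constructor
  · refine lt_of_le_of_ne h0 fun h' => ?_
    rw [← h'] at e
    linarith [h.1]
  · by_contra h'
    have : 1 ≤ modulus l ^ 2 := by nlinarith [not_lt.1 h']
    nlinarith [h.2, sq_nonneg (ae l)]

/-- The value of `h₃` at the elliptic coordinate `u`. -/
noncomputable def phaseC (l : Covector) (u : ℝ) : ℝ :=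
  -(Real.sign l.α * (2 * ae l * jacobiSc (modulus l) u * jacobiDn (modulus l) u))

/-- The value of `h₂` at the elliptic coordinate `u`. -/
noncomputable def phaseSinh (l : Covector) (u : ℝ) : ℝ :=
  2 * ae l ^ 2 * (1 - modulus l ^ 2 * (1 + jacobiCn (modulus l) u ^ 4)) /
    (l.α * jacobiCn (modulus l) u ^ 2)

/-- The value of `h₁` at the elliptic coordinate `u`. -/
noncomputable def phaseCosh (l : Covector) (u : ℝ) : ℝ :=
  2 * ae l ^ 2 * (1 - modulus l ^ 2 * (1 - jacobiCn (modulus l) u ^ 4)) /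
    (|l.α| * jacobiCn (modulus l) u ^ 2)

theorem phaseC_eq (hα : l.α ≠ 0) (u : ℝ) :
    phaseC l u = -(2 * ae l * l.α / |l.α|) * jacobiScDn (modulus l) u := by
  rw [phaseC, sign_eq_div_abs hα, jacobiScDn]
  ring

theorem phaseCosh_eq (l : Covector) (u : ℝ) :
    phaseCosh l u = 2 * ae l ^ 2 / |l.α| *
      ((1 - modulus l ^ 2 * (1 - jacobiCn (modulus l) u ^ 4)) / jacobiCn (modulus l) u ^ 2) := by
  rw [phaseCosh, mul_div_mul_comm]

/-- The two numerators have the form 2æ²(a ± b) with a = 1 - k² and b = k² cn⁴. The difference of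
their squares is 16æ⁴k²(1 - k²)cn⁴ = α² cn⁴, by `alpha_sq`. -/
theorem phaseCosh_sq (hα : l.α ≠ 0) {u : ℝ} (hu : jacobiCn (modulus l) u ≠ 0) :
    phaseCosh l u ^ 2 = 1 + phaseSinh l u ^ 2 := by
  have h := alpha_sq hα
  rw [phaseCosh, phaseSinh, div_pow, div_pow, mul_pow |l.α|, sq_abs]
  field_simp
  linear_combination (-jacobiCn (modulus l) u ^ 4) * h

theorem phaseCosh_pos (hα : l.α ≠ 0) {u : ℝ} (hu : 0 < jacobiCn (modulus l) u) :
    0 < phaseCosh l u := by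
  rw [phaseCosh_eq l]
  have := ae_pos hα
  have := abs_pos.2 hα
  exact mul_pos (by positivity) (jacobiScDn_deriv_pos (modulus_mem hα) hu)

theorem jacobiScDn_sq {k : ℝ} (hk : k ∈ Ioo (0 : ℝ) 1) {u : ℝ} (hu : jacobiCn k u ≠ 0) :
    jacobiScDn k u ^ 2 =
      (1 - k ^ 2) / jacobiCn k u ^ 2 + 2 * k ^ 2 - 1 - k ^ 2 * jacobiCn k u ^ 2 := by
  rw [jacobiScDn, jacobiSc, mul_pow, div_pow, jacobiDn_sq hk, jacobiSn_sq]
  field_simp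
  ring

/-- Both terms are Laurent polynomials in cn² with the same nonconstant part, so only the constant
2æ²(2k² - 1) survives. -/
theorem phase_energy (hα : l.α ≠ 0) {u : ℝ} (hu : jacobiCn (modulus l) u ≠ 0) :
    phaseC l u ^ 2 / 2 - l.α * phaseSinh l u = energy l := by
  rw [phaseC_eq hα, mul_pow, jacobiScDn_sq (modulus_mem hα) hu, energy_eq hα, phaseSinh,
    neg_sq, div_pow, sq_abs]
  field_simp
  ring

/-- The elliptic coordinate is determined by `c`. -/
theorem isPhase_of_c_eq (hα : l.α ≠ 0) {u : ℝ}
    (hu : u ∈ Ioo (-ellipticK (modulus l)) (ellipticK (modulus l))) (hc : l.c = phaseC l u) :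
    IsPhase l u := by
  have hcn := jacobiCn_pos (modulus_mem hα) hu
  have hs : Real.sinh l.θ = phaseSinh l u := by
    have h := phase_energy hα hcn.ne'
    rw [energy, ← hc] at h
    exact mul_left_cancel₀ hα (by linarith)
  refine ⟨hu, hc, hs, ?_⟩
  change _ = phaseCosh l u
  rw [← sq_eq_sq₀ (Real.cosh_pos _).le (phaseCosh_pos hα hcn).le, phaseCosh_sq hα hcn.ne', ← hs,
    Real.cosh_sq']

theorem existsUnique_isPhase (hα : l.α ≠ 0) : ∃! ψ : ℝ, IsPhase l ψ := by
  have hk := modulus_mem hα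
  have ha := (ae_pos hα).ne'
  have hb := (abs_pos.2 hα).ne'
  -- The value that sc·dn must take for `phaseC` to equal c.
  obtain ⟨u, hu, hPu⟩ := surjOn_jacobiScDn hk (mem_univ (-(l.c * |l.α| / (2 * ae l * l.α))))
  refine ⟨u, isPhase_of_c_eq hα hu ?_, fun v hv => (strictMonoOn_jacobiScDn hk).injOn hv.1 hu ?_⟩
  · rw [phaseC_eq hα, hPu]
    field_simp
  · have h : l.c = phaseC l v := hv.2.1
    rw [hPu, h, phaseC_eq hα]
    field_simp

theorem isPhase_psi₀ (hα : l.α ≠ 0) : IsPhase l (psi₀ l) :=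
  Classical.epsilon_spec (existsUnique_isPhase hα).exists

theorem blowupTime_pos (hα : l.α ≠ 0) : 0 < blowupTime l :=
  div_pos (sub_pos.2 (isPhase_psi₀ hα).1.2) (ae_pos hα)

theorem psi_lt_iff (hα : l.α ≠ 0) (t : ℝ) :
    psi l t < ellipticK (modulus l) ↔ t < blowupTime l := by
  rw [blowupTime, lt_div_iff₀ (ae_pos hα), psi]
  constructor <;> intro h <;> linarith

theorem psi_mem (hα : l.α ≠ 0) {t : ℝ} (h0 : 0 ≤ t) (ht : t < blowupTime l) :
    psi l t ∈ Ioo (-ellipticK (modulus l)) (ellipticK (modulus l)) := by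
  refine ⟨?_, (psi_lt_iff hα t).2 ht⟩
  have h := (isPhase_psi₀ hα).1.1
  have := mul_nonneg (ae_pos hα).le h0
  rw [psi]
  linarith

theorem psi_zero (l : Covector) : psi l 0 = psi₀ l := by simp [psi]

theorem hasDerivAt_psi (l : Covector) (t : ℝ) : HasDerivAt (psi l) (ae l) t := by
  exact (((hasDerivAt_id t).const_mul (ae l)).const_add (psi₀ l)).congr_deriv (mul_one _)

/-- The value of `θ` at the elliptic coordinate `u`. -/
noncomputable def phaseTheta (l : Covector) (u : ℝ) : ℝ := Real.arsinh (phaseSinh l u)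

theorem sinh_phaseTheta (l : Covector) (u : ℝ) : Real.sinh (phaseTheta l u) = phaseSinh l u :=
  Real.sinh_arsinh _

theorem cosh_phaseTheta (hα : l.α ≠ 0) {u : ℝ} (hu : 0 < jacobiCn (modulus l) u) :
    Real.cosh (phaseTheta l u) = phaseCosh l u := by
  rw [phaseTheta, Real.cosh_arsinh, ← phaseCosh_sq hα hu.ne', Real.sqrt_sq (phaseCosh_pos hα hu).le]

theorem hasDerivAt_phaseC (hα : l.α ≠ 0) {u : ℝ} (hu : jacobiCn (modulus l) u ≠ 0) :
    HasDerivAt (phaseC l) (-(l.α * phaseCosh l u) / ae l) u := by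
  rw [funext (phaseC_eq hα)]
  refine ((hasDerivAt_jacobiScDn (modulus_mem hα) hu).const_mul _).congr_deriv ?_
  have := (ae_pos hα).ne'
  rw [phaseCosh_eq l]
  field_simp

theorem hasDerivAt_phaseTheta (hα : l.α ≠ 0) {u : ℝ} (hu : 0 < jacobiCn (modulus l) u) :
    HasDerivAt (phaseTheta l) (-phaseC l u / ae l) u := by
  -- The energy identity makes sinh θ quadratic in c, so its derivative follows from that of c. It
  -- holds where cn ≠ 0, hence near u.
  have hsinh : phaseSinh l =ᶠ[𝓝 u] fun v => (phaseC l v ^ 2 / 2 - energy l) / l.α := by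
    filter_upwards [(continuous_jacobiCn (modulus_mem hα)).continuousAt.eventually_ne hu.ne']
      with v hv
    rw [← phase_energy hα hv]
    field_simp
    ring
  have hd : HasDerivAt (phaseSinh l) (-(phaseC l u * phaseCosh l u) / ae l) u := by
    refine (((((hasDerivAt_phaseC hα hu.ne').pow 2).div_const 2).sub_const _).div_const
      l.α |>.congr_of_eventuallyEq hsinh).congr_deriv ?_
    have := (ae_pos hα).ne'
    simp
    field_simp
  refine hd.arsinh.congr_deriv ?_
  rw [← Real.cosh_arsinh]
  change (Real.cosh (phaseTheta l u))⁻¹ • _ = _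
  rw [cosh_phaseTheta hα hu]
  have := (phaseCosh_pos hα hu).ne'
  rw [smul_eq_mul]
  field_simp

/-! ### The vertical flow in elliptic coordinates -/

theorem isVerticalCurve_phase (hα : l.α ≠ 0) :
    IsVerticalCurve l.α (fun t => phaseTheta l (psi l t)) (fun t => phaseC l (psi l t))
      (Ico 0 (blowupTime l)) where
  θ_eq t ht := by
    have hcn := jacobiCn_pos (modulus_mem hα) (psi_mem hα ht.1 ht.2)
    refine (((hasDerivAt_phaseTheta hα hcn).comp t
      (hasDerivAt_psi l t)).hasDerivWithinAt).congr_deriv ?_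
    exact div_mul_cancel₀ _ (ae_pos hα).ne'
  c_eq t ht := by
    have hcn := jacobiCn_pos (modulus_mem hα) (psi_mem hα ht.1 ht.2)
    refine (((hasDerivAt_phaseC hα hcn.ne').comp t
      (hasDerivAt_psi l t)).hasDerivWithinAt).congr_deriv ?_
    rw [cosh_phaseTheta hα hcn]
    exact div_mul_cancel₀ _ (ae_pos hα).ne'

theorem phaseTheta_psi₀ (hα : l.α ≠ 0) : phaseTheta l (psi₀ l) = l.θ := by
  rw [phaseTheta, show phaseSinh l (psi₀ l) = Real.sinh l.θ from (isPhase_psi₀ hα).2.2.1.symm,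
    Real.arsinh_sinh]

theorem ae_congr {l m : Covector} (hα : m.α = l.α) (hE : energy m = energy l) : ae m = ae l := by
  rw [ae, ae, hα, hE]

theorem modulus_congr {l m : Covector} (hα : m.α = l.α) (hE : energy m = energy l) :
    modulus m = modulus l := by
  rw [modulus, modulus, ae_congr hα hE, hE]

/-- Every solution of the vertical subsystem has constant energy and uniformly moving elliptic
coordinate. -/
theorem IsVerticalCurve.phase {θ c : ℝ → ℝ} {T : ℝ} (hα : l.α ≠ 0) (hT : 0 ≤ T)
    (h : IsVerticalCurve l.α θ c (Icc 0 T)) (hθ : θ 0 = l.θ) (hc : c 0 = l.c) :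
    T < blowupTime l ∧ ∀ t ∈ Icc 0 T, θ t = phaseTheta l (psi l t) ∧
      energy ⟨θ t, c t, l.α⟩ = energy l ∧ IsPhase ⟨θ t, c t, l.α⟩ (psi l t) := by
  have hk := modulus_mem hα
  have ha := (ae_pos hα).ne'
  have hb := (abs_pos.2 hα).ne'
  have hE : ∀ t ∈ Icc 0 T, energy ⟨θ t, c t, l.α⟩ = energy l := by
    refine eqOn_of_hasDerivWithinAt (g := fun _ => energy l) (f' := fun _ => 0) (fun t ht => ?_)
      (fun t _ => hasDerivWithinAt_const t _ _) (by simp [energy, hθ, hc])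
    refine ((((h.c_eq t ht).pow 2).div_const 2).sub
      (((h.θ_eq t ht).sinh).const_mul l.α)).congr_deriv ?_
    simp
    ring
  obtain ⟨Q, hQ, hPQ, hQP, hQd⟩ := exists_inverse_jacobiScDn hk
  -- The value of sc·dn that corresponds to c at time t. Thus Q (v t) is the elliptic coordinate
  -- read off from c alone.
  set v : ℝ → ℝ := fun t => -(|l.α| / (2 * ae l * l.α)) * c t with hv
  have hcQ : ∀ t, c t = phaseC l (Q (v t)) := by
    intro t
    rw [phaseC_eq hα, hPQ, hv]
    field_simp
  have hph : ∀ t ∈ Icc 0 T, IsPhase ⟨θ t, c t, l.α⟩ (Q (v t)) := by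
    intro t ht
    have e1 := ae_congr (l := l) (m := ⟨θ t, c t, l.α⟩) rfl (hE t ht)
    have e2 := modulus_congr (l := l) (m := ⟨θ t, c t, l.α⟩) rfl (hE t ht)
    refine isPhase_of_c_eq (l := ⟨θ t, c t, l.α⟩) hα (e2.symm ▸ hQ (v t)) ?_
    rw [phaseC, e1, e2]
    exact hcQ t
  have hcosh : ∀ t ∈ Icc 0 T, Real.cosh (θ t) = phaseCosh l (Q (v t)) := by
    intro t ht
    have e1 := ae_congr (l := l) (m := ⟨θ t, c t, l.α⟩) rfl (hE t ht)
    have e2 := modulus_congr (l := l) (m := ⟨θ t, c t, l.α⟩) rfl (hE t ht)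
    have := (hph t ht).2.2.2
    rw [e1, e2] at this
    exact this
  -- With p the derivative of sc·dn at Q (v t), cosh θ = 2æ²p/|α| gives v' = æp, while Q' = 1/p; the
  -- elliptic coordinate has speed æ.
  have hpsi : ∀ t ∈ Icc 0 T, Q (v t) = psi l t := by
    refine eqOn_of_hasDerivWithinAt (f' := fun _ => ae l) (fun t ht => ?_)
      (fun t _ => (hasDerivAt_psi l t).hasDerivWithinAt) ?_
    · refine ((hQd (v t)).comp_hasDerivWithinAt t ((h.c_eq t ht).const_mul _)).congr_deriv ?_
      rw [hcosh t ht, phaseCosh_eq l]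
      have hp := (jacobiScDn_deriv_pos hk (jacobiCn_pos hk (hQ (v t)))).ne'
      generalize (1 - modulus l ^ 2 * (1 - jacobiCn (modulus l) (Q (v t)) ^ 4)) /
        jacobiCn (modulus l) (Q (v t)) ^ 2 = p at hp
      field_simp
    · have h0 := isPhase_psi₀ hα
      have h1 : l.c = phaseC l (psi₀ l) := h0.2.1
      rw [psi_zero, ← hQP _ h0.1]
      congr 1
      rw [hv]
      simp only
      rw [hc, h1, phaseC_eq hα]
      field_simp
  refine ⟨?_, fun t ht => ⟨?_, hE t ht, hpsi t ht ▸ hph t ht⟩⟩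
  -- Q takes values below K, so ψ_T < K; this is the bound on the life span.
  · rw [← psi_lt_iff hα, ← hpsi T ⟨hT, le_rfl⟩]
    exact (hQ _).2
  · have e1 := ae_congr (l := l) (m := ⟨θ t, c t, l.α⟩) rfl (hE t ht)
    have e2 := modulus_congr (l := l) (m := ⟨θ t, c t, l.α⟩) rfl (hE t ht)
    have h3 := (hph t ht).2.2.1
    rw [e1, e2, hpsi t ht] at h3
    rw [phaseTheta, ← Real.arsinh_sinh (θ t)]
    exact congrArg _ h3

end Elliptic

/-! ### The curves with `α = 0` -/

theorem isVerticalCurve_degenerate (θ c : ℝ) (s : Set ℝ) :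
    IsVerticalCurve 0 (fun t => θ - c * t) (fun _ => c) s where
  θ_eq t _ := by
    simpa using (((hasDerivAt_id t).const_mul c).const_sub θ).hasDerivWithinAt
  c_eq t _ := by simpa using hasDerivWithinAt_const t s c

theorem IsVerticalCurve.degenerate {θ c : ℝ → ℝ} {T : ℝ} (h : IsVerticalCurve 0 θ c (Icc 0 T)) :
    ∀ t ∈ Icc 0 T, θ t = θ 0 - c 0 * t ∧ c t = c 0 := by
  have hc : ∀ t ∈ Icc 0 T, c t = c 0 :=
    eqOn_of_hasDerivWithinAt (g := fun _ => c 0) (f' := fun _ => 0)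
      (fun t ht => by simpa using h.c_eq t ht) (fun t _ => hasDerivWithinAt_const t _ _) rfl
  refine fun t ht => ⟨?_, hc t ht⟩
  refine eqOn_of_hasDerivWithinAt (g := fun t => θ 0 - c 0 * t) (f' := fun _ => -c 0)
    (fun t ht => by simpa [hc t ht] using h.θ_eq t ht) (fun t ht => ?_) (by simp) t ht
  exact (isVerticalCurve_degenerate (θ 0) (c 0) _).θ_eq t ht

theorem isHorizontalCurve_curveLine {l : Covector} (hc : l.c = 0) (s : Set ℝ) :
    IsHorizontalCurve (curveLine l) (fun t => l.θ - l.c * t) s where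
  x₁ t _ := by
    exact ((hasDerivAt_id t).const_mul (Real.cosh l.θ)).neg.hasDerivWithinAt.congr_deriv
      (by simp [hc])
  x₂ t _ := by
    simpa [curveLine, hc] using ((hasDerivAt_id t).const_mul (Real.sinh l.θ)).hasDerivWithinAt
  y t _ := by
    refine (hasDerivWithinAt_const t s (0 : ℝ)).congr_deriv ?_
    simp [curveLine, hc]
    ring
  z t _ := by
    refine (((hasDerivAt_id t).pow 3).const_mul
      ((2 * Real.sinh l.θ ^ 2 + 1) * Real.sinh l.θ / 6)).hasDerivWithinAt.congr_deriv ?_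
    simp [curveLine, hc, mul_pow, Real.cosh_sq]
    ring

theorem isHorizontalCurve_curveHyperbolic {l : Covector} (hc : l.c ≠ 0) (s : Set ℝ) :
    IsHorizontalCurve (curveHyperbolic l) (fun t => l.θ - l.c * t) s := by
  have hθ (t : ℝ) : HasDerivAt (fun t => l.θ - l.c * t) (-l.c) t := by
    simpa using ((hasDerivAt_id t).const_mul l.c).const_sub l.θ
  have hct (t : ℝ) : HasDerivAt (fun t => l.c * t) l.c t := by
    simpa using (hasDerivAt_id t).const_mul l.c
  refine ⟨fun t _ => ?_, fun t _ => ?_, fun t _ => ?_, fun t _ => ?_⟩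
  · refine (((hθ t).sinh.sub_const (Real.sinh l.θ)).div_const
      l.c).hasDerivWithinAt.congr_deriv ?_
    field_simp
  · refine (((hθ t).cosh.const_sub (Real.cosh l.θ)).div_const
      l.c).hasDerivWithinAt.congr_deriv ?_
    field_simp
  · refine (((hct t).sinh.sub (hct t)).div_const (2 * l.c ^ 2)).hasDerivWithinAt.congr_deriv ?_
    -- The velocity of y involves only θ and θ - ct, so ct is written as their difference.
    have e : Real.cosh (l.c * t) = Real.cosh l.θ * Real.cosh (l.θ - l.c * t) -
        Real.sinh l.θ * Real.sinh (l.θ - l.c * t) := by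
      rw [← Real.cosh_sub]; ring_nf
    have e' := Real.cosh_sq (l.θ - l.c * t)
    rw [e]
    simp [curveHyperbolic]
    field_simp
    linear_combination e'
  · have hu : HasDerivAt (fun t => l.c * t / 2) (l.c / 2) t := (hct t).div_const 2
    have hw : HasDerivAt (fun t => 3 * l.θ - 3 * l.c * t / 2) (-(3 * l.c / 2)) t := by
      simpa using (((hasDerivAt_id t).const_mul (3 * l.c)).div_const 2).const_sub (3 * l.θ)
    refine ((((((hu.sinh.pow 3).const_mul 4).mul hw.sinh).sub
      ((((hct t).sinh.sub (hct t)).const_mul 3).mul_const (Real.sinh l.θ))).div_const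
      (6 * l.c ^ 3))).hasDerivWithinAt.congr_deriv ?_
    -- With u = ct/2 and w = θ - u one has θ = w + u, θ - ct = w - u and 3θ - 3ct/2 = 3w. The claim
    -- becomes a polynomial identity in the hyperbolic functions of u and w, modulo cosh² = sinh² +
    -- 1.
    obtain ⟨u, rfl⟩ : ∃ u, t = 2 * u / l.c := ⟨l.c * t / 2, by field_simp⟩
    have e1 : l.c * (2 * u / l.c) = 2 * u := by field_simp
    have e2 : 3 * l.θ - 3 * l.c * (2 * u / l.c) / 2 = 3 * (l.θ - u) := by field_simp
    have e3 : l.θ - 2 * u = (l.θ - u) - u := by ring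
    have e4 : Real.sinh l.θ = Real.sinh ((l.θ - u) + u) := by ring_nf
    have e5 : Real.cosh l.θ = Real.cosh ((l.θ - u) + u) := by ring_nf
    have e6 : 2 * u / 2 = u := by ring
    simp [curveHyperbolic, e1, e2, e6]
    rw [e3, e4, e5]
    generalize l.θ - u = w
    simp only [Real.sinh_add, Real.cosh_add, Real.sinh_sub, Real.cosh_sub, Real.cosh_two_mul,
      Real.sinh_three_mul, Real.cosh_three_mul]
    have c1 := Real.cosh_sq u
    have c2 := Real.cosh_sq w
    have c3 : Real.cosh w ^ 3 = Real.cosh w * (Real.sinh w ^ 2 + 1) := by rw [← c2]; ring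
    have c4 : Real.cosh u ^ 3 = Real.cosh u * (Real.sinh u ^ 2 + 1) := by rw [← c1]; ring
    field_simp
    ring_nf
    simp only [c1, c2, c3, c4]
    ring

end Engel

namespace Engel

/-! ### The curves with `α ≠ 0` -/

/-! ### Primitives in the elliptic coordinate -/

section Primitives

variable {k : ℝ}

theorem hasDerivAt_jacobiSn_mul_jacobiDn (hk : k ∈ Ioo (0 : ℝ) 1) (u : ℝ) :
    HasDerivAt (fun u => jacobiSn k u * jacobiDn k u)
      (jacobiCn k u * (1 - 2 * k ^ 2 + 2 * k ^ 2 * jacobiCn k u ^ 2)) u := by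
  refine ((hasDerivAt_jacobiSn hk u).mul (hasDerivAt_jacobiDn hk u)).congr_deriv ?_
  linear_combination jacobiCn k u * jacobiDn_sq hk u -
    2 * k ^ 2 * jacobiCn k u * jacobiSn_sq k u

theorem jacobiSn_mul_jacobiDn_sq (hk : k ∈ Ioo (0 : ℝ) 1) (u : ℝ) :
    (jacobiSn k u * jacobiDn k u) ^ 2 =
      (1 - jacobiCn k u ^ 2) * (1 - k ^ 2 + k ^ 2 * jacobiCn k u ^ 2) := by
  rw [mul_pow, jacobiDn_sq hk, jacobiSn_sq]
  ring

theorem jacobiScDn_eq (k u : ℝ) : jacobiScDn k u = jacobiSn k u * jacobiDn k u / jacobiCn k u := by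
  rw [jacobiScDn, jacobiSc]
  ring

/-- A primitive of `-k² cn²`. -/
noncomputable def primX₂ (k u : ℝ) : ℝ := (1 - k ^ 2) * u - jacobiE k u

/-- The nontrivial part of the coordinate `y` as a function of the elliptic coordinate. -/
noncomputable def primY (k u : ℝ) : ℝ := k ^ 2 * jacobiCn k u ^ 2 + (1 - k ^ 2) * jacobiNc k u ^ 2

/-- The nontrivial part of the coordinate `z` as a function of the elliptic coordinate. -/
noncomputable def primZ (k u : ℝ) : ℝ :=
  2 * (k ^ 2 - 1) * u + (1 - k ^ 2) * (jacobiSn k u * jacobiDn k u / jacobiCn k u ^ 3) +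
    k ^ 2 * (jacobiCn k u * (jacobiSn k u * jacobiDn k u)) - 2 * (2 * k ^ 2 - 1) * jacobiE k u

theorem hasDerivAt_primX₂ (hk : k ∈ Ioo (0 : ℝ) 1) (u : ℝ) :
    HasDerivAt (primX₂ k) (-(k ^ 2 * jacobiCn k u ^ 2)) u := by
  refine (((hasDerivAt_id u).const_mul (1 - k ^ 2)).sub (hasDerivAt_jacobiE hk u)).congr_deriv ?_
  rw [jacobiDn_sq hk, jacobiSn_sq]
  ring

/-- Up to a constant factor the derivative is c sinh θ, the part of the velocity of y that
integration by parts leaves over. -/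
theorem hasDerivAt_primY (hk : k ∈ Ioo (0 : ℝ) 1) {u : ℝ} (hu : jacobiCn k u ≠ 0) :
    HasDerivAt (primY k)
      (2 * jacobiScDn k u * ((1 - k ^ 2 * (1 + jacobiCn k u ^ 4)) / jacobiCn k u ^ 2)) u := by
  have hc := hasDerivAt_jacobiCn hk u
  refine (((hc.pow 2).const_mul (k ^ 2)).add
    ((((hasDerivAt_const u (1 : ℝ)).div hc hu).pow 2).const_mul (1 - k ^ 2))).congr_deriv ?_
  rw [jacobiScDn_eq]
  simp
  field_simp
  ring

/-- The first term is c² sinh θ up to a constant factor. The second is a multiple of the derivative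
of sc·dn, and the final x₁ term in the formula for z cancels it. -/
theorem hasDerivAt_primZ (hk : k ∈ Ioo (0 : ℝ) 1) {u : ℝ} (hu : jacobiCn k u ≠ 0) :
    HasDerivAt (primZ k)
      (3 * jacobiScDn k u ^ 2 * ((1 - k ^ 2 * (1 + jacobiCn k u ^ 4)) / jacobiCn k u ^ 2) -
        (2 * k ^ 2 - 1) * ((1 - k ^ 2 * (1 - jacobiCn k u ^ 4)) / jacobiCn k u ^ 2)) u := by
  have hc := hasDerivAt_jacobiCn hk u
  have hm := hasDerivAt_jacobiSn_mul_jacobiDn hk u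
  refine (((((hasDerivAt_id u).const_mul (2 * (k ^ 2 - 1))).add
    ((hm.div (hc.pow 3) (pow_ne_zero 3 hu)).const_mul (1 - k ^ 2))).add
    ((hc.mul hm).const_mul (k ^ 2))).sub
    ((hasDerivAt_jacobiE hk u).const_mul (2 * (2 * k ^ 2 - 1)))).congr_deriv ?_
  have h2 := jacobiSn_mul_jacobiDn_sq hk u
  rw [jacobiScDn_eq, jacobiDn_sq hk, jacobiSn_sq]
  simp only [Pi.pow_apply]
  -- What remains is a rational identity in m = sn·dn and cn, with m² reduced by `h2`.
  generalize jacobiSn k u * jacobiDn k u = m at h2 ⊢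
  generalize jacobiCn k u = c at h2 hu ⊢
  simp
  field_simp
  ring_nf
  simp only [h2]
  ring

end Primitives

/-! ### Velocity of the explicit curve -/

section General

variable {l : Covector}

theorem genX₁_eq (l : Covector) (t : ℝ) : genX₁ l t =
    2 * ae l / |l.α| * (jacobiScDn (modulus l) (psi₀ l) - jacobiScDn (modulus l) (psi l t)) := rfl

theorem genX₂_eq (l : Covector) (t : ℝ) : genX₂ l t =
    (4 * ae l * (primX₂ (modulus l) (psi l t) - primX₂ (modulus l) (psi₀ l)) -
      |l.α| * genX₁ l t) / l.α := by
  simp only [genX₂, primX₂, psi]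
  ring

theorem genY_eq (l : Covector) (t : ℝ) : genY l t =
    -2 * ae l ^ 2 / (l.α * |l.α|) *
      (primY (modulus l) (psi l t) - primY (modulus l) (psi₀ l)) +
    ae l / |l.α| * (jacobiScDn (modulus l) (psi₀ l) + jacobiScDn (modulus l) (psi l t)) *
      genX₂ l t := by
  simp only [genY, primY, jacobiScDn]
  ring

theorem genZ_eq (l : Covector) (t : ℝ) : genZ l t =
    genX₂ l t ^ 3 / 6 +
    4 * ae l ^ 3 / (3 * l.α ^ 3) *
      (primZ (modulus l) (psi l t) - primZ (modulus l) (psi₀ l)) -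
    2 * ae l / |l.α| * jacobiScDn (modulus l) (psi₀ l) *
      (ae l / |l.α| * jacobiScDn (modulus l) (psi₀ l) * genX₂ l t -
        1 / 2 * genX₁ l t * genX₂ l t - genY l t) -
    2 * ae l ^ 2 / (3 * l.α * |l.α|) * (2 * modulus l ^ 2 - 1) * genX₁ l t := by
  have h (a b c d : ℝ) : 2 * a * (jacobiDn (modulus l) (psi₀ l)) * jacobiSn (modulus l) (psi₀ l) *
      d / (jacobiCn (modulus l) (psi₀ l) * b) =
      2 * a / b * jacobiScDn (modulus l) (psi₀ l) * d := by
    rw [jacobiScDn_eq, div_mul_div_comm, div_mul_eq_mul_div]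
    ring
  simp only [genZ, primZ]
  rw [h _ _ 0]
  simp only [psi, jacobiScDn]
  ring

theorem isHorizontalCurve_curveGeneral (hα : l.α ≠ 0) :
    IsHorizontalCurve (curveGeneral l) (fun t => phaseTheta l (psi l t))
      (Ico 0 (blowupTime l)) := by
  have hk := modulus_mem hα
  have hcn : ∀ t ∈ Ico 0 (blowupTime l), 0 < jacobiCn (modulus l) (psi l t) := fun t ht =>
    jacobiCn_pos hk (psi_mem hα ht.1 ht.2)
  have hb := (abs_pos.2 hα).ne'
  have d1 : ∀ t ∈ Ico 0 (blowupTime l),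
      HasDerivAt (genX₁ l) (-phaseCosh l (psi l t)) t := by
    intro t ht
    refine ((((hasDerivAt_jacobiScDn hk (hcn t ht).ne').comp t (hasDerivAt_psi l t)).const_sub
      (jacobiScDn (modulus l) (psi₀ l))).const_mul (2 * ae l / |l.α|)).congr_deriv ?_
    rw [phaseCosh_eq]
    ring
  -- The underlying identity is |α| cosh θ - α sinh θ = 4æ²k² cn².
  have d2 : ∀ t ∈ Ico 0 (blowupTime l),
      HasDerivAt (genX₂ l) (phaseSinh l (psi l t)) t := by
    intro t ht
    rw [funext (genX₂_eq l)]
    refine (((((hasDerivAt_primX₂ hk (psi l t)).comp t (hasDerivAt_psi l t)).sub_const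
      (primX₂ (modulus l) (psi₀ l))).const_mul (4 * ae l)).sub
      ((d1 t ht).const_mul |l.α|)).div_const l.α |>.congr_deriv ?_
    have := (hcn t ht).ne'
    rw [phaseCosh, phaseSinh]
    field_simp
    ring
  -- These two relations allow the quotients in cn to be replaced by free symbols A and B,
  -- proportional to sinh θ and cosh θ, so the remaining algebra contains no Jacobi identities.
  have hS : ∀ t, (1 - modulus l ^ 2 * (1 + jacobiCn (modulus l) (psi l t) ^ 4)) /
      jacobiCn (modulus l) (psi l t) ^ 2 * (2 * ae l ^ 2) = l.α * phaseSinh l (psi l t) := by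
    intro t
    rw [phaseSinh]
    field_simp
  have hC : ∀ t, (1 - modulus l ^ 2 * (1 - jacobiCn (modulus l) (psi l t) ^ 4)) /
      jacobiCn (modulus l) (psi l t) ^ 2 * (2 * ae l ^ 2) = |l.α| * phaseCosh l (psi l t) := by
    intro t
    rw [phaseCosh]
    field_simp
  have d3 : ∀ t ∈ Ico 0 (blowupTime l), HasDerivAt (genY l)
      ((phaseCosh l (psi l t) * genX₂ l t + phaseSinh l (psi l t) * genX₁ l t) / 2) t := by
    intro t ht
    rw [funext (genY_eq l)]
    refine (((((hasDerivAt_primY hk (hcn t ht).ne').comp t (hasDerivAt_psi l t)).sub_const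
      (primY (modulus l) (psi₀ l))).const_mul (-2 * ae l ^ 2 / (l.α * |l.α|))).add
      (((((hasDerivAt_jacobiScDn hk (hcn t ht).ne').comp t (hasDerivAt_psi l t)).const_add
      (jacobiScDn (modulus l) (psi₀ l))).const_mul (ae l / |l.α|)).mul (d2 t ht))).congr_deriv ?_
    have s := hS t
    have c := hC t
    have x := genX₁_eq l t
    simp only [Function.comp_apply]
    generalize (1 - modulus l ^ 2 * (1 + jacobiCn (modulus l) (psi l t) ^ 4)) /
      jacobiCn (modulus l) (psi l t) ^ 2 = A at s ⊢
    generalize (1 - modulus l ^ 2 * (1 - jacobiCn (modulus l) (psi l t) ^ 4)) /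
      jacobiCn (modulus l) (psi l t) ^ 2 = B at c ⊢
    rw [x]
    field_simp
    linear_combination (-4 * ae l * jacobiScDn (modulus l) (psi l t)) * s +
      l.α * genX₂ l t * c
  have d4 : ∀ t ∈ Ico 0 (blowupTime l), HasDerivAt (genZ l)
      (phaseSinh l (psi l t) * (genX₁ l t ^ 2 + genX₂ l t ^ 2) / 2) t := by
    intro t ht
    rw [funext (genZ_eq l)]
    refine (((((d2 t ht).pow 3).div_const 6).add
      ((((hasDerivAt_primZ hk (hcn t ht).ne').comp t (hasDerivAt_psi l t)).sub_const
        (primZ (modulus l) (psi₀ l))).const_mul (4 * ae l ^ 3 / (3 * l.α ^ 3)))).sub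
      (((((d2 t ht).const_mul (ae l / |l.α| * jacobiScDn (modulus l) (psi₀ l))).sub
        (((d1 t ht).const_mul (1 / 2)).mul (d2 t ht))).sub (d3 t ht)).const_mul
          (2 * ae l / |l.α| * jacobiScDn (modulus l) (psi₀ l)))).sub
      ((d1 t ht).const_mul (2 * ae l ^ 2 / (3 * l.α * |l.α|) * (2 * modulus l ^ 2 - 1)))
      |>.congr_deriv ?_
    have s := hS t
    have c := hC t
    have x := genX₁_eq l t
    generalize (1 - modulus l ^ 2 * (1 + jacobiCn (modulus l) (psi l t) ^ 4)) /
      jacobiCn (modulus l) (psi l t) ^ 2 = A at s ⊢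
    generalize (1 - modulus l ^ 2 * (1 - jacobiCn (modulus l) (psi l t) ^ 4)) /
      jacobiCn (modulus l) (psi l t) ^ 2 = B at c ⊢
    simp only [x]
    have s' : phaseSinh l (psi l t) = A * (2 * ae l ^ 2) / l.α := by rw [s]; field_simp
    have c' : phaseCosh l (psi l t) = B * (2 * ae l ^ 2) / |l.α| := by rw [c]; field_simp
    rw [s', c']
    rcases abs_choice l.α with h | h <;> rw [h] <;> simp <;> field_simp <;> ring
  refine ⟨fun t ht => ?_, fun t ht => ?_, fun t ht => ?_, fun t ht => ?_⟩
  · rw [cosh_phaseTheta hα (hcn t ht)]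
    exact (d1 t ht).hasDerivWithinAt
  · rw [sinh_phaseTheta]
    exact (d2 t ht).hasDerivWithinAt
  · rw [cosh_phaseTheta hα (hcn t ht), sinh_phaseTheta]
    exact (d3 t ht).hasDerivWithinAt
  · rw [sinh_phaseTheta]
    exact (d4 t ht).hasDerivWithinAt

theorem curveGeneral_zero (l : Covector) : curveGeneral l 0 = 0 := by
  have h1 : genX₁ l 0 = 0 := by simp [genX₁, psi_zero]
  have h2 : genX₂ l 0 = 0 := by simp [genX₂, psi_zero, h1]
  have h3 : genY l 0 = 0 := by simp [genY, psi_zero, h2]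
  have h4 : genZ l 0 = 0 := by simp [genZ, psi_zero, h1, h2, h3]
  ext i
  fin_cases i <;> simp [curveGeneral, h1, h2, h3, h4]

end General

/-! ### Blow-up -/

section Blowup

variable {l : Covector}

/-- Needed for the blow-up of y, whose leading coefficient is the increment of `primX₂` from ψ₀ to
K. The closed interval is required because K itself is an end point. -/
theorem primX₂_strictAntiOn {k : ℝ} (hk : k ∈ Ioo (0 : ℝ) 1) :
    StrictAntiOn (primX₂ k) (Icc (-ellipticK k) (ellipticK k)) := by
  refine strictAntiOn_of_deriv_neg (convex_Icc _ _)
    (fun u _ => (hasDerivAt_primX₂ hk u).continuousAt.continuousWithinAt) fun u hu => ?_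
  rw [interior_Icc] at hu
  rw [(hasDerivAt_primX₂ hk u).deriv, neg_lt_zero]
  have := jacobiCn_pos hk hu
  have := hk.1
  positivity

/-- `primY` and `primZ` in terms of `sc · dn`. -/
theorem primY_eq {k : ℝ} (hk : k ∈ Ioo (0 : ℝ) 1) {u : ℝ} (hu : jacobiCn k u ≠ 0) :
    primY k u = jacobiScDn k u ^ 2 + 1 - 2 * k ^ 2 + 2 * k ^ 2 * jacobiCn k u ^ 2 := by
  rw [jacobiScDn_sq hk hu, primY, jacobiNc]
  ring

/-- Isolates the cubic growth: apart from (sc·dn)³, what is left is linear in sc·dn with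
coefficients continuous up to K. -/
theorem primZ_eq {k : ℝ} (hk : k ∈ Ioo (0 : ℝ) 1) {u : ℝ} (hu : jacobiCn k u ≠ 0) :
    primZ k u = jacobiScDn k u ^ 3 + (1 - 2 * k ^ 2 + 2 * k ^ 2 * jacobiCn k u ^ 2) *
      jacobiScDn k u + (2 * (k ^ 2 - 1) * u - 2 * (2 * k ^ 2 - 1) * jacobiE k u) := by
  have h := jacobiScDn_sq hk hu
  have e : jacobiScDn k u ^ 3 = jacobiScDn k u ^ 2 * jacobiScDn k u := by ring
  rw [e, h, primZ, jacobiScDn_eq]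
  field_simp
  ring

/-- The rate of growth of a cubic expression whose leading coefficient is a continuous function. -/
theorem tendsto_cubic_of_continuous {ι : Type*} {L : Filter ι} {p u : ι → ℝ} {K : ℝ}
    (hp : Tendsto p L atTop) (hu : Tendsto u L (𝓝 K)) {G : ℝ × ℝ → ℝ} (hG : Continuous G)
    (hG0 : 0 < G (0, K)) : Tendsto (fun i => p i ^ 3 * G ((p i)⁻¹, u i)) L atTop := by
  have h1 : Tendsto (fun i => ((p i)⁻¹, u i)) L (𝓝 (0, K)) :=
    (tendsto_inv_atTop_zero.comp hp).prodMk_nhds hu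
  exact ((tendsto_pow_atTop three_ne_zero).comp hp).atTop_mul_pos hG0
    ((hG.tendsto (0, K)).comp h1)

theorem tendsto_abs_curveGeneral (hα : l.α ≠ 0) (i : Fin 4) :
    Tendsto (fun t => |curveGeneral l t i|) (𝓝[<] blowupTime l) atTop := by
  have hk := modulus_mem hα
  have hae := ae_pos hα
  have habs := abs_pos.2 hα
  have hpsi : Tendsto (psi l) (𝓝[<] blowupTime l) (𝓝[<] ellipticK (modulus l)) := by
    refine tendsto_nhdsWithin_iff.2 ⟨?_, ?_⟩
    · have h := (hasDerivAt_psi l (blowupTime l)).continuousAt.tendsto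
      have e : psi l (blowupTime l) = ellipticK (modulus l) := by
        rw [psi, blowupTime]; field_simp; ring
      rw [e] at h
      exact h.mono_left nhdsWithin_le_nhds
    · filter_upwards [self_mem_nhdsWithin] with t ht
      exact (psi_lt_iff hα t).2 ht
  have hu : Tendsto (psi l) (𝓝[<] blowupTime l) (𝓝 (ellipticK (modulus l))) :=
    hpsi.mono_right nhdsWithin_le_nhds
  have hp := (tendsto_jacobiScDn hk).comp hpsi
  have hev : ∀ᶠ t in 𝓝[<] blowupTime l, jacobiCn (modulus l) (psi l t) ≠ 0 := by
    filter_upwards [Ioo_mem_nhdsLT (blowupTime_pos hα)] with t ht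
    exact (jacobiCn_pos hk (psi_mem hα ht.1.le ht.2)).ne'
  have hpos : ∀ᶠ t in 𝓝[<] blowupTime l, 0 < jacobiScDn (modulus l) (psi l t) :=
    hp.eventually_gt_atTop 0
  have hcn0 : jacobiCn (modulus l) (psi₀ l) ≠ 0 := (jacobiCn_pos hk (isPhase_psi₀ hα).1).ne'
  have hcU : Continuous (primX₂ (modulus l)) :=
    continuous_iff_continuousAt.2 fun u => (hasDerivAt_primX₂ hk u).continuousAt
  have hcE : Continuous (jacobiE (modulus l)) :=
    continuous_iff_continuousAt.2 fun u => (hasDerivAt_jacobiE hk u).continuousAt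
  have hcC := continuous_jacobiCn hk
  have hU : primX₂ (modulus l) (ellipticK (modulus l)) < primX₂ (modulus l) (psi₀ l) := by
    have h := (isPhase_psi₀ hα).1
    exact primX₂_strictAntiOn hk (Ioo_subset_Icc_self h)
      ⟨by linarith [ellipticK_pos hk], le_rfl⟩ h.2
  set k := modulus l with hkdef
  set P₀ := jacobiScDn k (psi₀ l) with hP₀
  set D : ℝ → ℝ := fun u => primX₂ k u - primX₂ k (psi₀ l) with hD
  have hcD : Continuous D := hcU.sub continuous_const
  have hDu : Tendsto (fun t => D (psi l t)) (𝓝[<] blowupTime l) (𝓝 (D (ellipticK k))) :=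
    (hcD.tendsto _).comp hu
  have hD0 : D (ellipticK k) < 0 := sub_neg.2 hU
  have scale : ∀ {f g : ℝ → ℝ} {a : ℝ}, a ≠ 0 → Tendsto g (𝓝[<] blowupTime l) atTop →
      (∀ᶠ t in 𝓝[<] blowupTime l, f t = a * g t) →
      Tendsto (fun t => |f t|) (𝓝[<] blowupTime l) atTop := by
    intro f g a ha hg hfg
    refine ((tendsto_abs_atTop_atTop.comp hg).const_mul_atTop (abs_pos.2 ha)).congr' ?_
    filter_upwards [hfg] with t ht
    simp [ht, abs_mul]
  have x1 : ∀ t, genX₁ l t = 2 * ae l / |l.α| * (P₀ - jacobiScDn k (psi l t)) := fun _ => rfl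
  have x2 : ∀ t, genX₂ l t =
      2 * ae l / l.α * (2 * D (psi l t) - P₀ + jacobiScDn k (psi l t)) := by
    intro t
    rw [genX₂_eq, x1, hD]
    field_simp
    ring
  have y : ∀ t, jacobiCn k (psi l t) ≠ 0 → genY l t = 4 * ae l ^ 2 / (l.α * |l.α|) *
      (D (psi l t) * (P₀ + jacobiScDn k (psi l t)) -
        k ^ 2 * (jacobiCn k (psi l t) ^ 2 - jacobiCn k (psi₀ l) ^ 2)) := by
    intro t ht
    rw [genY_eq, x2, primY_eq hk ht, primY_eq hk hcn0]
    field_simp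
    ring
  fin_cases i
  · refine scale (f := genX₁ l) (a := -(2 * ae l / |l.α|)) (neg_ne_zero.2 (by positivity))
      (tendsto_atTop_add_const_left _ (-P₀) hp) (Eventually.of_forall fun t => ?_)
    rw [x1, Function.comp_apply]
    ring
  · refine scale (f := genX₂ l) (a := 2 * ae l / l.α) (div_ne_zero (by positivity) hα)
      (((hDu.const_mul 2).sub_const P₀).add_atTop hp) (Eventually.of_forall fun t => ?_)
    rw [x2, Function.comp_apply]
  -- The coefficient -D tends to a positive limit, so y grows linearly in sc·dn ψ_t; the terms in
  -- cn² stay bounded.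
  · have h1 : Tendsto (fun t => -D (psi l t) * (P₀ + jacobiScDn k (psi l t)))
        (𝓝[<] blowupTime l) atTop :=
      hDu.neg.pos_mul_atTop (neg_pos.2 hD0) (tendsto_atTop_add_const_left _ P₀ hp)
    have h2 : Tendsto (fun t => k ^ 2 * (jacobiCn k (psi l t) ^ 2 - jacobiCn k (psi₀ l) ^ 2))
        (𝓝[<] blowupTime l)
        (𝓝 (k ^ 2 * (jacobiCn k (ellipticK k) ^ 2 - jacobiCn k (psi₀ l) ^ 2))) :=
      ((((hcC.tendsto _).comp hu).pow 2).sub_const _).const_mul _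
    refine scale (f := genY l) (a := -(4 * ae l ^ 2 / (l.α * |l.α|)))
      (neg_ne_zero.2 (div_ne_zero (by positivity) (mul_ne_zero hα habs.ne')))
      (h2.add_atTop h1) ?_
    filter_upwards [hev] with t ht
    rw [y t ht]
    ring
  -- G is z divided by p³ and by its constant prefactor, written in e = (1/p, ψ_t) with p = sc·dn
  -- ψ_t. At 1/p = 0 it equals 2: x₂³/6 and `primZ` contribute 1 each, and every other term is of
  -- lower order.
  · let B : ℝ → ℝ := fun u => 2 * (k ^ 2 - 1) * u - 2 * (2 * k ^ 2 - 1) * jacobiE k u -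
      primZ k (psi₀ l) - (2 * k ^ 2 - 1) * P₀
    let G : ℝ × ℝ → ℝ := fun e =>
      (e.1 * (2 * D e.2 - P₀) + 1) ^ 3 + 1 +
        (1 - 2 * k ^ 2 + 2 * k ^ 2 * jacobiCn k e.2 ^ 2 + (2 * k ^ 2 - 1)) * e.1 ^ 2 +
        B e.2 * e.1 ^ 3 -
        3 * P₀ * (e.1 * (e.1 * (2 * D e.2 - P₀) + 1) -
          2 * (D e.2 * (P₀ * e.1 ^ 3 + e.1 ^ 2) -
            k ^ 2 * (jacobiCn k e.2 ^ 2 - jacobiCn k (psi₀ l) ^ 2) * e.1 ^ 3))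
    have hG : Continuous G := by fun_prop
    refine scale (f := genZ l) (a := 4 * ae l ^ 3 / (3 * l.α ^ 3))
      (div_ne_zero (by positivity) (mul_ne_zero three_ne_zero (pow_ne_zero 3 hα)))
      (tendsto_cubic_of_continuous hp hu hG (by simp [G])) ?_
    filter_upwards [hev, hpos] with t ht htp
    rw [genZ_eq, y t ht, x2, x1, primZ_eq hk ht]
    simp only [G, B, Function.comp_apply]
    have := htp.ne'
    rcases abs_choice l.α with h | h <;> rw [h] <;> field_simp <;> ring

end Blowup

end Engel

namespace Engel

/-! ### Assembly -/

theorem existsUnique_covector_zero (l : Covector) : ∃! ξ : Fin 4 → ℝ, HasCoords 0 ξ l := by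
  refine ⟨![Real.cosh l.θ, Real.sinh l.θ, l.c, l.α], ?_, ?_⟩
  · simp [HasCoords, h₁_eq, h₂_eq, h₃_eq, h₄_eq]
  · rintro ξ ⟨e1, e2, e3, e4⟩
    simp only [h₁_eq, h₂_eq, h₃_eq, h₄_eq, Pi.zero_apply] at e1 e2 e3 e4
    ext i
    fin_cases i <;> simp <;> linarith

theorem level_iff_existsUnique_hasCoords (ξ : Fin 4 → ℝ) :
    (hamiltonian 0 ξ = -1 / 2 ∧ 0 < h₁ 0 ξ) ↔ ∃! l : Covector, HasCoords 0 ξ l := by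
  constructor
  · rintro ⟨hH, hpos⟩
    refine ⟨⟨Real.arsinh (h₂ 0 ξ), h₃ 0 ξ, h₄ 0 ξ⟩,
      ⟨?_, (Real.sinh_arsinh _).symm, rfl, rfl⟩, ?_⟩
    · rw [Real.cosh_arsinh, eq_comm, Real.sqrt_eq_iff_mul_self_eq_of_pos hpos]
      rw [hamiltonian] at hH
      linarith
    · rintro m ⟨-, e2, e3, e4⟩
      ext
      · simp [e2]
      · exact e3.symm
      · exact e4.symm
  · rintro ⟨l, ⟨e1, e2, -, -⟩, -⟩
    rw [hamiltonian, e1, e2, Real.cosh_sq]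
    exact ⟨by ring, Real.cosh_pos _⟩

theorem coe_lt_tSup_iff {l : Covector} (hα : l.α ≠ 0) (t : ℝ) :
    (t : EReal) < tSup l ↔ t < blowupTime l := by
  rw [tSup, if_pos hα, EReal.coe_lt_coe_iff]

theorem explicitCurve_zero (l : Covector) : explicitCurve l 0 = 0 := by
  unfold explicitCurve
  split_ifs
  · exact curveGeneral_zero l
  · ext i
    fin_cases i <;> simp [curveHyperbolic]
  · ext i
    fin_cases i <;> simp [curveLine]

theorem isHorizontalCurve_explicitCurve {l : Covector} (hα : l.α = 0) (s : Set ℝ) :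
    IsHorizontalCurve (explicitCurve l) (fun t => l.θ - l.c * t) s := by
  rw [explicitCurve, if_neg (not_not.2 hα)]
  split_ifs with hc
  · exact isHorizontalCurve_curveHyperbolic hc s
  · exact isHorizontalCurve_curveLine (not_not.1 hc) s

theorem exists_isExtremalFrom (l : Covector) : ∃ q ξ : ℝ → Fin 4 → ℝ,
    IsExtremalFrom l q ξ {t : ℝ | 0 ≤ t ∧ (t : EReal) < tSup l} := by
  by_cases hα : l.α = 0
  · have hv := isVerticalCurve_degenerate l.θ l.c {t : ℝ | 0 ≤ t ∧ (t : EReal) < tSup l}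
    obtain ⟨ξ, hξ, hc⟩ := exists_isNormalExtremal (isHorizontalCurve_explicitCurve hα _) hv
    exact ⟨_, ξ, hξ, explicitCurve_zero l, by simpa [HasCoords, hα] using hc 0⟩
  · have hs : {t : ℝ | 0 ≤ t ∧ (t : EReal) < tSup l} = Ico 0 (blowupTime l) := by
      ext t
      exact and_congr_right fun _ => coe_lt_tSup_iff hα t
    obtain ⟨ξ, hξ, hc⟩ := exists_isNormalExtremal (isHorizontalCurve_curveGeneral hα)
      (isVerticalCurve_phase hα)
    refine ⟨_, ξ, hs ▸ hξ, curveGeneral_zero l, ?_⟩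
    have h0 := hc 0
    rw [psi_zero, phaseTheta_psi₀ hα,
      show phaseC l (psi₀ l) = l.c from (isPhase_psi₀ hα).2.1.symm] at h0
    exact h0

/-- The vertical part fixes θ along the extremal; the given curve and the explicit one are then
horizontal over the same θ with the same origin. -/
theorem IsExtremalFrom.eq_explicitCurve {l : Covector} {T : ℝ} {q ξ : ℝ → Fin 4 → ℝ}
    (h : IsExtremalFrom l q ξ (Icc 0 T)) (hT : 0 ≤ T) :
    (T : EReal) < tSup l ∧ ∀ t ∈ Icc 0 T, q t = explicitCurve l t ∧
      ∃ m : Covector, HasCoords (q t) (ξ t) m ∧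
        (l.α ≠ 0 → m.α = l.α ∧ energy m = energy l ∧ IsPhase m (psi l t)) ∧
        (l.α = 0 → m.θ = l.θ - l.c * t ∧ m.c = l.c ∧ m.α = 0) := by
  obtain ⟨θ, c, hθ0, hc0, hco, hv, hq⟩ := h.exists_coords hT
  have h0 : q 0 = explicitCurve l 0 := h.2.1.trans (explicitCurve_zero l).symm
  by_cases hα : l.α = 0
  · have hd := (hα ▸ hv : IsVerticalCurve 0 θ c (Icc 0 T)).degenerate
    rw [hθ0, hc0] at hd
    have hE := (hq.congr fun t ht => (hd t ht).1).eqOn (isHorizontalCurve_explicitCurve hα _) h0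
    refine ⟨by simp [tSup, hα], fun t ht => ⟨hE t ht, _, hco t ht, fun h => (h hα).elim, fun _ => ?_⟩⟩
    exact ⟨(hd t ht).1, (hd t ht).2, hα⟩
  · obtain ⟨hTb, hph⟩ := hv.phase hα hT hθ0 hc0
    have hG : IsHorizontalCurve (explicitCurve l) (fun t => phaseTheta l (psi l t)) (Icc 0 T) := by
      rw [explicitCurve, if_pos hα]
      exact (isHorizontalCurve_curveGeneral hα).mono fun t ht => ⟨ht.1, ht.2.trans_lt hTb⟩
    have hE := (hq.congr fun t ht => (hph t ht).1).eqOn hG h0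
    refine ⟨(coe_lt_tSup_iff hα T).2 hTb, fun t ht => ⟨hE t ht, _, hco t ht, fun _ => ?_,
      fun h => (hα h).elim⟩⟩
    exact ⟨rfl, (hph t ht).2⟩

theorem Exp_eq_explicitCurve (p : N) : Exp p = explicitCurve p.1.1 p.1.2 := by
  obtain ⟨⟨l, t⟩, ht0, ht⟩ := p
  have hex : ∃ (q ξ : ℝ → Fin 4 → ℝ), IsExtremalFrom l q ξ (Icc 0 t) := by
    obtain ⟨q, ξ, hN, hi⟩ := exists_isExtremalFrom l
    exact ⟨q, ξ, hN.mono fun τ hτ =>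
      ⟨hτ.1, lt_of_le_of_lt (EReal.coe_le_coe_iff.2 hτ.2) ht⟩, hi⟩
  rw [Exp, dif_pos hex]
  -- Whatever extremal the choice returns, uniqueness identifies its end point.
  have hs := hex.choose_spec.choose_spec
  exact ((hs.eq_explicitCurve (le_of_lt ht0)).2 t ⟨le_of_lt ht0, le_rfl⟩).1

theorem h₃_reflect (q ξ : Fin 4 → ℝ) : h₃ (reflect q) (reflect ξ) = -h₃ q ξ := by
  simp [h₃_eq, reflect]; ring

theorem h₄_reflect (q ξ : Fin 4 → ℝ) : h₄ (reflect q) (reflect ξ) = h₄ q ξ := by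
  simp [h₄_eq, reflect]

theorem reflect_reflect (q : Fin 4 → ℝ) : reflect (reflect q) = q := by
  ext i
  fin_cases i <;> simp [reflect]

theorem reflect_zero : reflect 0 = 0 := by
  ext i
  fin_cases i <;> simp [reflect]

end Engel

theorem mainTheorem3 :
    -- the initial covectors with `H = -1/2`, `h₁ > 0` are parametrized by `(θ, c, α) ∈ ℝ³`
    (∀ l : Engel.Covector, ∃! ξ : Fin 4 → ℝ, Engel.HasCoords 0 ξ l) ∧
    (∀ ξ : Fin 4 → ℝ, (Engel.hamiltonian 0 ξ = -1 / 2 ∧ 0 < Engel.h₁ 0 ξ) ↔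
      ∃! l : Engel.Covector, Engel.HasCoords 0 ξ l) ∧
    -- the elliptic coordinates are well defined for `α ≠ 0`
    (∀ l : Engel.Covector, l.α ≠ 0 →
      0 < Engel.ae l ∧ Engel.modulus l ∈ Set.Ioo (0 : ℝ) 1 ∧
      (∃! ψ : ℝ, Engel.IsPhase l ψ) ∧ 0 < Engel.blowupTime l) ∧
    -- for every `l` an extremal exists on `[0, t_sup)`
    (∀ l : Engel.Covector, ∃ q ξ : ℝ → Fin 4 → ℝ,
      Engel.IsExtremalFrom l q ξ {t : ℝ | 0 ≤ t ∧ (t : EReal) < Engel.tSup l}) ∧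
    -- every extremal from the origin is given by the explicit formulas and ends before `t_sup`
    (∀ (l : Engel.Covector) (T : ℝ) (q ξ : ℝ → Fin 4 → ℝ), 0 < T →
      Engel.IsExtremalFrom l q ξ (Set.Icc 0 T) →
      (T : EReal) < Engel.tSup l ∧
      ∀ t ∈ Set.Icc 0 T, q t = Engel.explicitCurve l t ∧
        ∃ m : Engel.Covector, Engel.HasCoords (q t) (ξ t) m ∧
          (l.α ≠ 0 → m.α = l.α ∧ Engel.energy m = Engel.energy l ∧
            Engel.IsPhase m (Engel.psi l t)) ∧
          (l.α = 0 → m.θ = l.θ - l.c * t ∧ m.c = l.c ∧ m.α = 0)) ∧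
    -- blow-up at `t_sup` for `α ≠ 0`
    (∀ l : Engel.Covector, l.α ≠ 0 → ∀ i : Fin 4,
      Filter.Tendsto (fun t => |Engel.explicitCurve l t i|)
        (nhdsWithin (Engel.blowupTime l) (Set.Iio (Engel.blowupTime l))) Filter.atTop) ∧
    -- the exponential map
    (∀ p : Engel.N, Engel.Exp p = Engel.explicitCurve p.1.1 p.1.2) ∧
    -- all normal extremals from the origin on the level `H = -1/2`, both signs of `h₁`
    (∀ (T : ℝ) (q ξ : ℝ → Fin 4 → ℝ), 0 < T →
      Engel.IsNormalExtremal q ξ (Set.Icc 0 T) → q 0 = 0 →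
      Engel.hamiltonian (q 0) (ξ 0) = -1 / 2 →
      ∃ l : Engel.Covector, (T : EReal) < Engel.tSup l ∧
        ((0 < Engel.h₁ (q 0) (ξ 0) ∧ Engel.HasCoords (q 0) (ξ 0) l ∧
            ∀ t ∈ Set.Icc 0 T, q t = Engel.explicitCurve l t) ∨
          (Engel.h₁ (q 0) (ξ 0) < 0 ∧
            -Engel.h₁ (q 0) (ξ 0) = Real.cosh l.θ ∧ Engel.h₂ (q 0) (ξ 0) = Real.sinh l.θ ∧
            -Engel.h₃ (q 0) (ξ 0) = l.c ∧ Engel.h₄ (q 0) (ξ 0) = l.α ∧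
            ∀ t ∈ Set.Icc 0 T, q t = Engel.reflect (Engel.explicitCurve l t)))) := by
  refine ⟨Engel.existsUnique_covector_zero, Engel.level_iff_existsUnique_hasCoords,
    fun l hα => ⟨Engel.ae_pos hα, Engel.modulus_mem hα, Engel.existsUnique_isPhase hα,
      Engel.blowupTime_pos hα⟩,
    Engel.exists_isExtremalFrom, fun l T q ξ hT h => h.eq_explicitCurve hT.le,
    fun l hα i => ?_, Engel.Exp_eq_explicitCurve, fun T q ξ hT h hq0 hH => ?_⟩
  · rw [Engel.explicitCurve, if_pos hα]
    exact Engel.tendsto_abs_curveGeneral hα i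
  · have key : ∀ {q ξ : ℝ → Fin 4 → ℝ}, Engel.IsNormalExtremal q ξ (Icc 0 T) → q 0 = 0 →
        Engel.hamiltonian (q 0) (ξ 0) = -1 / 2 → 0 < Engel.h₁ (q 0) (ξ 0) →
        ∃ l : Engel.Covector, Engel.HasCoords (q 0) (ξ 0) l ∧ (T : EReal) < Engel.tSup l ∧
          ∀ t ∈ Icc 0 T, q t = Engel.explicitCurve l t := by
      intro q ξ h hq0 hH hpos
      obtain ⟨l, hl, -⟩ := (Engel.level_iff_existsUnique_hasCoords (ξ 0)).1 (hq0 ▸ ⟨hH, hpos⟩)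
      rw [← hq0] at hl
      obtain ⟨h1, h2⟩ := Engel.IsExtremalFrom.eq_explicitCurve ⟨h, hq0, hl⟩ hT.le
      exact ⟨l, hl, h1, fun t ht => (h2 t ht).1⟩
    rcases lt_trichotomy (Engel.h₁ (q 0) (ξ 0)) 0 with hneg | h0 | hpos
    · obtain ⟨l, ⟨i1, i2, i3, i4⟩, hTs, hl⟩ := key h.reflect (by simp [hq0, Engel.reflect_zero])
        (by rw [Engel.hamiltonian, Engel.h₁_reflect, Engel.h₂_reflect, neg_sq]; exact hH)
        (by rw [Engel.h₁_reflect]; linarith)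
      rw [Engel.h₁_reflect] at i1
      rw [Engel.h₂_reflect] at i2
      rw [Engel.h₃_reflect] at i3
      rw [Engel.h₄_reflect] at i4
      exact ⟨l, hTs, Or.inr ⟨hneg, i1, i2, i3, i4, fun t ht => by
        rw [← hl t ht, Engel.reflect_reflect]⟩⟩
    · rw [Engel.hamiltonian, h0] at hH
      -- With h₁ = 0 the level condition would read h₂² = -1.
      nlinarith [sq_nonneg (Engel.h₂ (q 0) (ξ 0))]
    · obtain ⟨l, hl, hTs, hq⟩ := key h hq0 hH hpos
      exact ⟨l, hTs, Or.inl ⟨hpos, hl, hq⟩⟩
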